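/- Let $\alpha=\cos^2(\pi/8)$, let $H=\frac1{\sqrt2}\begin{pmatrix}1&1\\1&-1\end{pmatrix}$ be the Hadamard gate, and for $b\in\{0,1\}^n$ let $H^b=H^{b_1}\otimes\cdots\otimes H^{b_n}$. For a real number $\eta$, the scheme $\mathsf{CTMAC}^\eta$ for one-bit documents with security parameter $n$ is as follows. The secret key $k=(a,b)$ is uniformly random in $\{0,1\}^n\times\{0,1\}^n$; the token is the $n$-qubit state $H^b|a\rangle$; a document $m\in\{0,1\}$ is signed by applying $(H^m)^{\otimes n}$ to the token and measuring in the computational basis, the outcome being the signature; and $\sigma\in\{0,1\}^n$ is accepted as a signature of $m$ if and only if $\#\{i : b_i=m,\ \sigma_i\ne a_i\}\le\eta n$. In the unforgeability game, a key is generated and kept secret. An adversary, which may perform arbitrary finite-dimensional quantum operations and measurements (without any computational bound), may adaptively query the token oracle (each query returns the token $H^b|a\rangle$) at most once, and the verification oracle (which, on a classical query $(m,\sigma)$, tells whether $\sigma$ is accepted for $m$). Finally it submits a finite list of documents with alleged signatures. It wins if at least $r+1$ distinct documents appear in the list with an accepted signature, where $r\in\{0,1\}$ is the number of its token queries. (So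 with one token it has to submit valid signatures for both $0$ and $1$.) The scheme is *unconditionally unforgeable* if for every family of such adversaries, one for each $n$, whose numbers of verification queries and of submitted documents are bounded by polynomials in $n$, the winning probability is negligible, i.e. decreases to $0$ faster than every inverse polynomial in $n$. **Theorem.** Let $0<\eta<\frac{1-\alpha}{2}$. Then $\mathsf{CTMAC}^\eta$ is unconditionally unforgeable. Moreover, the winning probability is exponentially small: there are constants $C>0$ and $0<\rho<1$, depending only on $\eta$, such that for every $n\ge0$, every adversary that makes at most one token query and at most $q$ verification queries and submits at most $w$ documents wins with probability at most $C\,(q+w+1)^2\rho^{\,n}$. In particular, $0.07<\frac{1-\alpha}{2}$, and $\mathsf{CTMAC}^{0.07}$ is unconditionally unforgeable. -/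

import Mathlib

open scoped Matrix Kronecker

noncomputable section

namespace ConjugateTMAC

/-- Bit strings of length `n`; also the computational basis of an `n`-qubit register. -/
abbrev Bits (n : ℕ) : Type := Fin n → Bool

/-! ### The scheme `CTMAC^η` (documents are single bits, `false = 0`, `true = 1`) -/

/-- The one-qubit Hadamard gate `(1/√2) * [[1, 1], [1, -1]]`. -/
def hadamardGate : Matrix Bool Bool ℂ :=
  Matrix.of fun x y => (if x && y then -1 else 1) * (((Real.sqrt 2)⁻¹ : ℝ) : ℂ)

/-- The `n`-qubit operator `H^b = H^{b_1} ⊗ ⋯ ⊗ H^{b_n}`, by its matrix entries in the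
computational basis. -/
def hadamardPow {n : ℕ} (b : Bits n) : Matrix (Bits n) (Bits n) ℂ :=
  Matrix.of fun x y => ∏ i, (if b i then hadamardGate else 1) (x i) (y i)

/-- A secret key `k = (a, b)`. Key generation samples it uniformly. -/
abbrev Key (n : ℕ) : Type := Bits n × Bits n

/-- Token generation: the pure `n`-qubit state `H^b |a⟩`. -/
def token {n : ℕ} (k : Key n) : Bits n → ℂ :=
  hadamardPow k.2 *ᵥ Pi.single k.1 1

/-- The token as a density matrix. -/
def tokenState {n : ℕ} (k : Key n) : Matrix (Bits n) (Bits n) ℂ :=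
  Matrix.vecMulVec (token k) (star (token k))

/-- Signing: the probability that signing the document `m` with the token `ψ`, that is, measuring
`(H^m)^{⊗ n} ψ` in the computational basis, gives the signature `σ`. -/
def signProb {n : ℕ} (ψ : Bits n → ℂ) (m : Bool) (σ : Bits n) : ℝ :=
  ‖(hadamardPow (fun _ => m) *ᵥ ψ) σ‖ ^ 2

/-- The coordinates prepared in the basis of `m` at which `σ` differs from `a`. -/
def miss {n : ℕ} (k : Key n) (m : Bool) (σ : Bits n) : Finset (Fin n) :=
  Finset.univ.filter fun i => k.2 i = m ∧ σ i ≠ k.1 i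

/-- Verification: accept if and only if there are at most `η n` misses. -/
def verify {n : ℕ} (η : ℝ) (k : Key n) (m : Bool) (σ : Bits n) : Bool :=
  decide (((miss k m σ).card : ℝ) ≤ η * n)

/-! ### Adversaries and the unforgeability game -/

/-- A computationally unbounded quantum adversary with oracle access, as a finite decision tree.
`Strategy n X` is the type of strategies of an adversary whose quantum memory at present is the
finite-dimensional Hilbert space with orthonormal basis `X`; the classical information it holds
is its position in the tree.

* `submit L`: stop and send the list `L` of documents with alleged signatures to the challenger.
* `queryVerify m σ next`: one classical query to the verification oracle; the answer is the
  argument of `next`.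
* `queryToken next`: one query to the token oracle; the token is appended to the memory.
* `measure K _ next`: an arbitrary quantum measurement with Kraus operators `K i`, possibly to a
  memory of another dimension; the outcome `i` is the argument of `next`. Unitaries, preparation
  of ancillas, randomness, channels and general instruments are the cases in which `next` ignores
  part or all of the outcome. -/
inductive Strategy (n : ℕ) : Type → Type 1
  | submit {X : Type} (L : List (Bool × Bits n)) : Strategy n X
  | queryVerify {X : Type} (m : Bool) (σ : Bits n) (next : Bool → Strategy n X) : Strategy n X
  | queryToken {X : Type} (next : Strategy n (X × Bits n)) : Strategy n X
  | measure {X Y : Type} [DecidableEq X] [Fintype Y] {o : ℕ} (K : Fin o → Matrix Y X ℂ)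
      (hK : ∑ i, (K i)ᴴ * K i = 1) (next : Fin o → Strategy n Y) : Strategy n X

namespace Strategy

variable {n : ℕ}

/-- The largest number of token queries on any branch. -/
def tokenQueries : {X : Type} → Strategy n X → ℕ
  | _, submit _ => 0
  | _, queryVerify _ _ next => max (next false).tokenQueries (next true).tokenQueries
  | _, queryToken next => next.tokenQueries + 1
  | _, measure _ _ next => Finset.univ.sup fun i => (next i).tokenQueries

/-- The largest number of verification queries on any branch. -/
def verifyQueries : {X : Type} → Strategy n X → ℕ
  | _, submit _ => 0
  | _, queryVerify _ _ next => max (next false).verifyQueries (next true).verifyQueries + 1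
  | _, queryToken next => next.verifyQueries
  | _, measure _ _ next => Finset.univ.sup fun i => (next i).verifyQueries

/-- The largest number of signed documents submitted at the end of any branch. -/
def submissions : {X : Type} → Strategy n X → ℕ
  | _, submit L => L.length
  | _, queryVerify _ _ next => max (next false).submissions (next true).submissions
  | _, queryToken next => next.submissions
  | _, measure _ _ next => Finset.univ.sup fun i => (next i).submissions

end Strategy

/-- The number of distinct documents with a valid signature in the list `L`. -/
def validCount {n : ℕ} (η : ℝ) (k : Key n) (L : List (Bool × Bits n)) : ℕ :=
  ((L.filter fun p => verify η k p.1 p.2).map Prod.fst).toFinset.card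

/-- The probability that the strategy wins against the key `k`, when `r` tokens have been handed
out so far and the (subnormalized) state of the memory is `ρ`; the trace of `ρ` is the probability
of having reached this position. The adversary wins if it submits valid signatures for at least
`r + 1` distinct documents, where `r` is the number of tokens it has asked for. -/
def winProb {n : ℕ} (η : ℝ) (k : Key n) :
    {X : Type} → [Fintype X] → Strategy n X → ℕ → Matrix X X ℂ → ℝ
  | _, _, .submit L, r, ρ => if r + 1 ≤ validCount η k L then ρ.trace.re else 0
  | _, _, .queryVerify m σ next, r, ρ => winProb η k (next (verify η k m σ)) r ρ
  | _, _, .queryToken next, r, ρ => winProb η k next (r + 1) (ρ ⊗ₖ tokenState k)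
  | _, _, @Strategy.measure _ _ _ _ _ _ K _ next, r, ρ => ∑ i, winProb η k (next i) r (K i * ρ * (K i)ᴴ)

/-- The probability that an adversary, which starts with trivial memory, wins the unforgeability
game for `CTMAC^η` with security parameter `n`: the key is uniformly random. -/
def forgeProb (η : ℝ) (n : ℕ) (S : Strategy n Unit) : ℝ :=
  (∑ k : Key n, winProb η k S 0 1) / Fintype.card (Key n)

/-- `f` is bounded by a polynomial. -/
def PolyBounded (f : ℕ → ℕ) : Prop :=
  ∃ p : Polynomial ℕ, ∀ n, f n ≤ p.eval n

/-- `f` decreases to zero faster than every inverse polynomial. -/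
def Negligible (f : ℕ → ℝ) : Prop :=
  Asymptotics.SuperpolynomialDecay Filter.atTop (fun n : ℕ => (n : ℝ)) f

/-- `CTMAC^η` is unforgeable against computationally unbounded adversaries that make at most one
token query and polynomially many classical verification queries, and submit polynomially many
signed documents. -/
def UnconditionallyUnforgeable (η : ℝ) : Prop :=
  ∀ A : (n : ℕ) → Strategy n Unit,
    (∀ n, (A n).tokenQueries ≤ 1) →
    PolyBounded (fun n => (A n).verifyQueries) →
    PolyBounded (fun n => (A n).submissions) →
    Negligible (fun n => forgeProb η n (A n))

end ConjugateTMAC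

end

/-!
The adversary faces verification queries whose answers depend on the key. Up to the first accepted
signature all answers are negative, so they carry no information and the position in the decision
tree is independent of the key. If the first accepted signature `σ` is one of the document `m`,
later queries on `m` reveal at most all the bases `b` and the bits of `a` encoded in the basis `m`
(`revealed`). Handing over this information, and answering queries on the other document
negatively up to the first success, turns the rest of the strategy into a measurement whose
outcome is an attempt to sign the other document (`exists_attempts`), with total weight at most the
number of queries and submissions. Summing over the first success as well gives the quadratic
factor (`sum_winProb_of_token_le`). A signature accepted before the token is handed out is an
exponentially unlikely guess (`sum_ite_verify_le`, `sum_winProb_le`).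

What remains is to bound the probability that `σ` and the attempt `σ'`, which may depend on the
revealed information, together have at most `2 η n` misses (`sum_verify_le`). The indicator of this
event is at most `t ^ (misses - 2 η n)` for `0 < t ≤ 1`, and `t ^ misses` is the probability that
there is no miss in a random set `R` which contains each coordinate with probability `1 - t`. So it
is enough to bound the probability of having no miss on a given `R` by `guess ^ R.card`, where
`guess = cos² (π / 8)` (`sum_matchOn_token_le`); averaging over `R` then gives the bound
`rate η t ^ n` with `rate η t = t ^ (-2 η) * ((1 - t) * guess + t)`, and this base is less than `1`
for `t` close to `1` if `η < (1 - guess) / 2` (`exists_rate_lt_one`).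

The bound for a given `R` is proved as for a monogamy-of-entanglement game. For each choice of bases
`b` on `R` the winning event is an operator `T_b† T_b` on the maps that take the token to the
memory. No miss on `R` pins the bits encoded in the basis `m` to `σ`, which is fixed before the
bases are revealed; hence at each coordinate where `b` and `b'` differ, the product `T_b T_b'†`
contains the overlap `1 / √2` of two states from different bases, with one of them known, and
`‖T_b T_b'†‖ ≤ 2 ^ (-d / 2)` for bases at Hamming distance `d` (`norm_sum_overlap_le`). The Schur
test (`sum_le_of_overlap_le`) bounds the norm of `∑ b, T_b† T_b` by
`∑ d, (R.card choose d) * 2 ^ (-d / 2) = (1 + 1 / √2) ^ R.card = (2 * guess) ^ R.card`.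
-/

namespace ConjugateTMAC

/-! ### Pure states and tokens -/

section

/-- The squared Euclidean norm of a vector of amplitudes. -/
noncomputable def sqNorm {ι : Type*} [Fintype ι] (v : ι → ℂ) : ℝ := ∑ i, ‖v i‖ ^ 2

/-- The (unnormalized) pure state `|v⟩⟨v|`. -/
def pureState {X : Type*} (v : X → ℂ) : Matrix X X ℂ := Matrix.vecMulVec v (star v)

lemma sqNorm_nonneg {ι : Type*} [Fintype ι] (v : ι → ℂ) : 0 ≤ sqNorm v :=
  Finset.sum_nonneg fun _ _ => sq_nonneg _

lemma trace_pureState {X : Type*} [Fintype X] (v : X → ℂ) :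
    (pureState v).trace.re = sqNorm v := by
  simp only [pureState, Matrix.trace, Matrix.diag, Matrix.vecMulVec_apply, Pi.star_apply,
    RCLike.star_def, Complex.mul_conj, sqNorm, Complex.re_sum, Complex.ofReal_re,
    Complex.normSq_eq_norm_sq]

lemma mul_pureState_mul {X Y : Type*} [Fintype X] (K : Matrix Y X ℂ) (v : X → ℂ) :
    K * pureState v * Kᴴ = pureState (K *ᵥ v) := by
  rw [pureState, pureState, Matrix.mul_vecMulVec, Matrix.vecMulVec_mul, Matrix.star_mulVec]

lemma pureState_kronecker {X Y : Type*} (v : X → ℂ) (w : Y → ℂ) :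
    pureState v ⊗ₖ pureState w = pureState fun p : X × Y => v p.1 * w p.2 := by
  ext p q
  simp [pureState, Matrix.vecMulVec_apply]
  ring

lemma sqNorm_eq_dotProduct {ι : Type*} [Fintype ι] (v : ι → ℂ) :
    (sqNorm v : ℂ) = star v ⬝ᵥ v := by
  simp only [sqNorm, dotProduct, Pi.star_apply, RCLike.star_def, Complex.conj_mul']
  push_cast
  rfl

lemma sum_sqNorm_mulVec {X Y : Type*} [Fintype X] [DecidableEq X] [Fintype Y] {o : ℕ}
    {K : Fin o → Matrix Y X ℂ} (hK : ∑ i, (K i)ᴴ * K i = 1) (v : X → ℂ) :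
    ∑ i, sqNorm (K i *ᵥ v) = sqNorm v := by
  have h : ((∑ i, sqNorm (K i *ᵥ v) : ℝ) : ℂ) = (sqNorm v : ℂ) := by
    push_cast
    simp only [sqNorm_eq_dotProduct]
    calc ∑ i, star (K i *ᵥ v) ⬝ᵥ (K i *ᵥ v)
        = ∑ i, star v ⬝ᵥ (((K i)ᴴ * K i) *ᵥ v) := by
          refine Finset.sum_congr rfl fun i _ => ?_
          rw [Matrix.star_mulVec, ← Matrix.dotProduct_mulVec, Matrix.mulVec_mulVec]
      _ = star v ⬝ᵥ v := by
          rw [← dotProduct_sum, ← Matrix.sum_mulVec, hK, Matrix.one_mulVec]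
  exact_mod_cast h

lemma token_apply {n : ℕ} (k : Key n) (x : Bits n) :
    token k x = ∏ i, (if k.2 i then hadamardGate else 1) (x i) (k.1 i) := by
  simp [token, hadamardPow]

lemma tokenState_eq {n : ℕ} (k : Key n) : tokenState k = pureState (token k) := rfl

/-- Overlap of two of the four states of the BB84 encoding. -/
lemma sum_qubit_overlap (b b' a a' : Bool) :
    ∑ x, star ((if b then hadamardGate else 1) x a) * (if b' then hadamardGate else 1) x a' =
      if b = b' then (if a = a' then 1 else 0)
      else (((if a && a' then -1 else 1) * (Real.sqrt 2)⁻¹ : ℝ) : ℂ) := by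
  have h : ((Real.sqrt 2 : ℝ) : ℂ)⁻¹ * ((Real.sqrt 2 : ℝ) : ℂ)⁻¹ = 1 / 2 := by
    rw [← mul_inv, ← Complex.ofReal_mul, Real.mul_self_sqrt (by norm_num)]
    norm_num
  cases b <;> cases b' <;> cases a <;> cases a' <;>
    simp [hadamardGate, Matrix.one_apply, Complex.conj_ofReal, h]
  all_goals norm_num

lemma sum_token_overlap {n : ℕ} (a b a' b' : Bits n) :
    ∑ x, star (token (a, b) x) * token (a', b') x =
      ∏ i, if b i = b' i then (if a i = a' i then (1 : ℂ) else 0)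
        else (((if a i && a' i then -1 else 1) * (Real.sqrt 2)⁻¹ : ℝ) : ℂ) := by
  simp only [token_apply, star_prod, ← Finset.prod_mul_distrib, ← sum_qubit_overlap]
  rw [Finset.prod_univ_sum, Fintype.piFinset_univ]

lemma sqNorm_token {n : ℕ} (k : Key n) : sqNorm (token k) = 1 := by
  have h := sqNorm_eq_dotProduct (token k)
  have h2 := sum_token_overlap k.1 k.2 k.1 k.2
  simp only [if_true, Finset.prod_const_one] at h2
  rw [dotProduct] at h
  simp only [Pi.star_apply] at h
  rw [h2] at h
  exact_mod_cast h

lemma sqNorm_tensor {X Y : Type*} [Fintype X] [Fintype Y] (v : X → ℂ) (w : Y → ℂ) :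
    sqNorm (fun p : X × Y => v p.1 * w p.2) = sqNorm v * sqNorm w := by
  simp only [sqNorm, norm_mul, mul_pow, Fintype.sum_prod_type, Finset.sum_mul_sum]

variable {n : ℕ} {η : ℝ} {k : Key n}

lemma winProb_measure {X Y : Type} [Fintype X] [DecidableEq X] [Fintype Y] {o : ℕ}
    (K : Fin o → Matrix Y X ℂ) (hK : ∑ i, (K i)ᴴ * K i = 1) (next : Fin o → Strategy n Y)
    (r : ℕ) (v : X → ℂ) :
    winProb η k (.measure K hK next) r (pureState v) =
      ∑ i, winProb η k (next i) r (pureState (K i *ᵥ v)) := by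
  simp only [winProb, mul_pureState_mul]

lemma winProb_queryToken {X : Type} [Fintype X] (next : Strategy n (X × Bits n))
    (r : ℕ) (v : X → ℂ) :
    winProb η k (.queryToken next) r (pureState v) =
      winProb η k next (r + 1) (pureState fun p => v p.1 * token k p.2) := by
  simp only [winProb, tokenState_eq, pureState_kronecker]

/-- The winning probability is at most the probability of having reached the present position. -/
lemma winProb_mem_Icc {X : Type} (S : Strategy n X) :
    ∀ [Fintype X] (r : ℕ) (v : X → ℂ),
      winProb η k S r (pureState v) ∈ Set.Icc 0 (sqNorm v) := by
  induction S with
  | submit L =>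
    intro _ r v
    simp only [winProb, trace_pureState]
    split_ifs
    · exact ⟨sqNorm_nonneg v, le_rfl⟩
    · exact ⟨le_rfl, sqNorm_nonneg v⟩
  | queryVerify m σ next ih =>
    intro _ r v
    simp only [winProb]
    exact ih _ r v
  | queryToken next ih =>
    intro _ r v
    rw [winProb_queryToken]
    have := ih (r + 1) fun p => v p.1 * token k p.2
    rwa [sqNorm_tensor, sqNorm_token, mul_one] at this
  | measure K hK next ih =>
    intro inst r v
    rw [winProb_measure, ← sum_sqNorm_mulVec hK]
    exact ⟨Finset.sum_nonneg fun i _ => (ih i r _).1, Finset.sum_le_sum fun i _ => (ih i r _).2⟩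

end

section

/-! ### A Schur test -/

/-- A Schur test for sums of positive terms `s b = ⟪V, T_b† T_b V⟫`, with `y b = T_b† T_b V`:
if the overlaps of the `y b` decay, the terms cannot all be large. -/
lemma sum_le_of_overlap_le {F ι : Type*} [NormedAddCommGroup F] [InnerProductSpace ℂ F]
    (B : Finset ι) (V : F) (y : ι → F) (s : ι → ℝ) (κ : ι → ι → ℝ) {Λ : ℝ} (hΛ : 0 ≤ Λ)
    (hs : ∀ b ∈ B, 0 ≤ s b) (hV : ∀ b ∈ B, (inner ℂ V (y b)).re = s b)
    (hκ : ∀ b b', 0 ≤ κ b b') (hsymm : ∀ b b', κ b b' = κ b' b)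
    (hy : ∀ b ∈ B, ∀ b' ∈ B, ‖inner ℂ (y b) (y b')‖ ≤ κ b b' * (√(s b) * √(s b')))
    (hrow : ∀ b ∈ B, ∑ b' ∈ B, κ b b' ≤ Λ) :
    ∑ b ∈ B, s b ≤ Λ * ‖V‖ ^ 2 := by
  set S := ∑ b ∈ B, s b with hS
  have hS0 : 0 ≤ S := Finset.sum_nonneg hs
  have h1 : S ≤ ‖V‖ * ‖∑ b ∈ B, y b‖ := by
    calc S = (inner ℂ V (∑ b ∈ B, y b)).re := by
          rw [inner_sum, Complex.re_sum]
          exact Finset.sum_congr rfl fun b hb => (hV b hb).symm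
      _ ≤ ‖inner ℂ V (∑ b ∈ B, y b)‖ := Complex.re_le_norm _
      _ ≤ _ := norm_inner_le_norm _ _
  have h2 : ‖∑ b ∈ B, y b‖ ^ 2 ≤ Λ * S := by
    have hnorm : ‖∑ b ∈ B, y b‖ ^ 2 ≤ ∑ b ∈ B, ∑ b' ∈ B, ‖inner ℂ (y b) (y b')‖ := by
      have h := inner_self_eq_norm_sq_to_K (𝕜 := ℂ) (∑ b ∈ B, y b)
      have h' : ‖∑ b ∈ B, y b‖ ^ 2 = ‖inner ℂ (∑ b ∈ B, y b) (∑ b ∈ B, y b)‖ := by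
        rw [h]; simp
      rw [h', sum_inner]
      refine (norm_sum_le _ _).trans (Finset.sum_le_sum fun b _ => ?_)
      rw [inner_sum]
      exact norm_sum_le _ _
    have hterm : ∀ b ∈ B, ∀ b' ∈ B,
        ‖inner ℂ (y b) (y b')‖ ≤ κ b b' * s b / 2 + κ b' b * s b' / 2 := by
      intro b hb b' hb'
      refine (hy b hb b' hb').trans ?_
      rw [hsymm b' b]
      have e1 := Real.sq_sqrt (hs b hb)
      have e2 := Real.sq_sqrt (hs b' hb')
      have := mul_le_mul_of_nonneg_left (two_mul_le_add_sq (√(s b)) (√(s b'))) (hκ b b')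
      rw [e1, e2] at this
      linarith
    have hsum : ∑ b ∈ B, ∑ b' ∈ B, κ b b' * s b / 2 ≤ Λ * S / 2 := by
      rw [hS, Finset.mul_sum, Finset.sum_div]
      refine Finset.sum_le_sum fun b hb => ?_
      rw [← Finset.sum_div, ← Finset.sum_mul]
      have := mul_le_mul_of_nonneg_right (hrow b hb) (hs b hb)
      linarith
    calc ‖∑ b ∈ B, y b‖ ^ 2
        ≤ ∑ b ∈ B, ∑ b' ∈ B, (κ b b' * s b / 2 + κ b' b * s b' / 2) :=
          hnorm.trans (Finset.sum_le_sum fun b hb => Finset.sum_le_sum fun b' hb' =>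
            hterm b hb b' hb')
      _ = ∑ b ∈ B, ∑ b' ∈ B, κ b b' * s b / 2 + ∑ b ∈ B, ∑ b' ∈ B, κ b b' * s b / 2 := by
          simp only [Finset.sum_add_distrib]
          congr 1
          exact Finset.sum_comm
      _ ≤ Λ * S := by linarith
  have h3 : S * S ≤ (Λ * ‖V‖ ^ 2) * S := by
    calc S * S ≤ (‖V‖ * ‖∑ b ∈ B, y b‖) * (‖V‖ * ‖∑ b ∈ B, y b‖) :=
          mul_self_le_mul_self hS0 h1
      _ = ‖V‖ ^ 2 * ‖∑ b ∈ B, y b‖ ^ 2 := by ring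
      _ ≤ ‖V‖ ^ 2 * (Λ * S) := mul_le_mul_of_nonneg_left h2 (sq_nonneg _)
      _ = _ := by ring
  rcases hS0.eq_or_lt with h | h
  · rw [← h]; positivity
  · exact le_of_mul_le_mul_right h3 h

/-! ### Overlaps of tokens -/

variable {n : ℕ}

/-- The bit string `a` with the bits outside `D` erased. -/
def mask (D : Finset (Fin n)) (a : Bits n) : Bits n := fun i => if i ∈ D then a i else false

lemma mask_eq_mask_iff {D : Finset (Fin n)} {a a' : Bits n} :
    mask D a = mask D a' ↔ ∀ i ∈ D, a i = a' i := by
  constructor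
  · intro h i hi
    simpa [mask, hi] using congrFun h i
  · intro h
    funext i
    by_cases hi : i ∈ D <;> simp [mask, hi, h]

/-- The coordinates at which two bit strings agree. -/
def agree (b b' : Bits n) : Finset (Fin n) := Finset.univ.filter fun i => b i = b' i

lemma mem_agree {b b' : Bits n} {i : Fin n} : i ∈ agree b b' ↔ b i = b' i := by simp [agree]

lemma agree_comm (b b' : Bits n) : agree b b' = agree b' b := by
  ext i; simp only [mem_agree, eq_comm]

/-- The sign `(-1)^(x y)`. -/
def bitSign (x y : Bool) : ℂ := if x && y then -1 else 1

lemma norm_bitSign (x y : Bool) : ‖bitSign x y‖ = 1 := by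
  unfold bitSign; split_ifs <;> simp

/-- If at each coordinate where `b` and `b'` differ one of `a`, `a'` (the one encoded in the basis
`m`) is pinned to `σ`, then the overlap of two tokens has rank one up to a restriction to the
coordinates where `b` and `b'` agree: its sign splits into a factor depending on `a` and one
depending on `a'`. -/
lemma token_overlap_eq {a b a' b' σ : Bits n} {m : Bool}
    (h : ∀ i, b i ≠ b' i → b i = m → a i = σ i) (h' : ∀ i, b i ≠ b' i → b' i = m → a' i = σ i) :
    ∑ x, star (token (a', b') x) * token (a, b) x =
      if mask (agree b b') a = mask (agree b b') a' then
        (((√2)⁻¹ ^ (agree b b')ᶜ.card : ℝ) : ℂ) *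
          ((∏ i ∈ (agree b b')ᶜ, if b i = m then 1 else bitSign (σ i) (a i)) *
            ∏ i ∈ (agree b b')ᶜ, if b i = m then bitSign (σ i) (a' i) else 1)
      else 0 := by
  rw [sum_token_overlap]
  split_ifs with hm
  · rw [mask_eq_mask_iff] at hm
    rw [← Finset.prod_mul_prod_compl (agree b b'), Finset.prod_eq_one, one_mul,
      Complex.ofReal_pow, ← Finset.prod_const, ← Finset.prod_mul_distrib,
      ← Finset.prod_mul_distrib]
    · refine Finset.prod_congr rfl fun i hi => ?_
      rw [Finset.mem_compl, mem_agree] at hi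
      rw [if_neg (Ne.symm hi)]
      by_cases hb : b i = m
      · rw [if_pos hb, if_pos hb, h i hi hb, bitSign, Bool.and_comm]
        split_ifs <;> simp
      · have hb' : b' i = m := by
          revert hi hb; cases b i <;> cases b' i <;> cases m <;> simp
        rw [if_neg hb, if_neg hb, h' i hi hb', bitSign]
        split_ifs <;> simp
    · intro i hi
      rw [if_pos (mem_agree.1 hi).symm, if_pos (hm i hi).symm]
  · rw [mask_eq_mask_iff] at hm
    push Not at hm
    obtain ⟨i, hi, hne⟩ := hm
    refine Finset.prod_eq_zero (Finset.mem_univ i) ?_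
    rw [if_pos (mem_agree.1 hi).symm, if_neg (Ne.symm hne)]

variable {E : Type*} [NormedAddCommGroup E] [InnerProductSpace ℂ E]

lemma sum_fiber_inner {α β : Type*} [Fintype α] [Fintype β] [DecidableEq β] (g : α → β)
    (u u' : α → E) :
    ∑ a, ∑ a', (if g a = g a' then inner ℂ (u a) (u' a') else 0) =
      ∑ d, inner ℂ (∑ a with g a = d, u a) (∑ a with g a = d, u' a) := by
  rw [← Finset.sum_fiberwise (s := Finset.univ) (g := g)]
  refine Finset.sum_congr rfl fun d _ => ?_
  rw [sum_inner]
  refine Finset.sum_congr rfl fun a ha => ?_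
  rw [inner_sum, Finset.sum_filter]
  refine Finset.sum_congr rfl fun a' _ => ?_
  rw [(Finset.mem_filter.1 ha).2]
  simp only [eq_comm (a := d)]

/-- On each class of strings `a` that agree on the coordinates in `D`, the vectors `u a` add up,
with whatever phases, to a vector of squared norm at most `L * ∑ a, s a`. This holds for
`u a = N a (f a)` and `s a = ⟪f a, N a (f a)⟫` if the positive operators `N a` of each class add up
to at most `L`. -/
def SquareSummable (D : Finset (Fin n)) (L : ℝ) (s : Bits n → ℝ) (u : Bits n → E) : Prop :=
  ∀ φ : Bits n → ℂ, (∀ a, ‖φ a‖ ≤ 1) → ∀ d,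
    ‖∑ a with mask D a = d, φ a • u a‖ ^ 2 ≤ L * ∑ a with mask D a = d, s a

/-- The bound `‖T_b T_b'†‖ ≤ L * 2 ^ (-d / 2)`, where `d` is the number of coordinates at which `b`
and `b'` differ, in the form needed for the Schur test. -/
lemma norm_sum_overlap_le {b b' σ : Bits n} {m : Bool} {u u' : Bits n → E} {s s' : Bits n → ℝ}
    {L : ℝ} (hL : 0 ≤ L) (hs : ∀ a, 0 ≤ s a) (hs' : ∀ a, 0 ≤ s' a)
    (hu0 : ∀ a, u a ≠ 0 → ∀ i, b i ≠ b' i → b i = m → a i = σ i)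
    (hu0' : ∀ a, u' a ≠ 0 → ∀ i, b i ≠ b' i → b' i = m → a i = σ i)
    (hu : SquareSummable (agree b b') L s u) (hu' : SquareSummable (agree b b') L s' u') :
    ‖∑ a, ∑ a', (∑ x, star (token (a', b') x) * token (a, b) x) * inner ℂ (u a) (u' a')‖ ≤
      L * (√2)⁻¹ ^ (agree b b')ᶜ.card * (√(∑ a, s a) * √(∑ a, s' a)) := by
  set D := agree b b'
  set φ : Bits n → ℂ := fun a => ∏ i ∈ Dᶜ, if b i = m then 1 else bitSign (σ i) (a i) with hφ
  set φ' : Bits n → ℂ := fun a => ∏ i ∈ Dᶜ, if b i = m then bitSign (σ i) (a i) else 1 with hφ'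
  have hn : ∀ a, ‖(starRingEnd ℂ) (φ a)‖ ≤ 1 := fun a => by
    rw [RCLike.norm_conj, hφ]
    refine (norm_prod _ _).trans_le (Finset.prod_le_one (fun _ _ => norm_nonneg _) fun i _ => ?_)
    split_ifs <;> simp [norm_bitSign]
  have hn' : ∀ a, ‖φ' a‖ ≤ 1 := fun a => by
    rw [hφ']
    refine (norm_prod _ _).trans_le (Finset.prod_le_one (fun _ _ => norm_nonneg _) fun i _ => ?_)
    split_ifs <;> simp [norm_bitSign]
  have key : ∑ a, ∑ a', (∑ x, star (token (a', b') x) * token (a, b) x) *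
        inner ℂ (u a) (u' a') =
      (((√2)⁻¹ ^ Dᶜ.card : ℝ) : ℂ) *
        ∑ d, inner ℂ (∑ a with mask D a = d, (starRingEnd ℂ) (φ a) • u a)
          (∑ a with mask D a = d, φ' a • u' a) := by
    rw [← sum_fiber_inner, Finset.mul_sum]
    refine Finset.sum_congr rfl fun a _ => ?_
    rw [Finset.mul_sum]
    refine Finset.sum_congr rfl fun a' _ => ?_
    by_cases h0 : u a = 0
    · simp [h0]
    by_cases h0' : u' a' = 0
    · simp [h0']
    rw [token_overlap_eq (hu0 a h0) (hu0' a' h0')]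
    split_ifs
    · rw [inner_smul_left, inner_smul_right, Complex.conj_conj]
      ring
    · simp
  have hsq : ∀ x : ℝ, 0 ≤ x → ∀ y, x ^ 2 ≤ L * y → x ≤ √L * √y := fun x hx y h => by
    rw [← Real.sqrt_mul hL]
    exact Real.le_sqrt_of_sq_le h
  rw [key, norm_mul, Complex.norm_real, Real.norm_of_nonneg (by positivity),
    mul_comm L, mul_assoc]
  refine mul_le_mul_of_nonneg_left ?_ (by positivity)
  calc _ ≤ ∑ d, (√L * √(∑ a with mask D a = d, s a)) * (√L * √(∑ a with mask D a = d, s' a)) := by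
        refine (norm_sum_le _ _).trans (Finset.sum_le_sum fun d _ => ?_)
        refine (norm_inner_le_norm _ _).trans (mul_le_mul ?_ ?_ (norm_nonneg _) (by positivity))
        · exact hsq _ (norm_nonneg _) _ (hu _ hn d)
        · exact hsq _ (norm_nonneg _) _ (hu' _ hn' d)
    _ = L * ∑ d, √(∑ a with mask D a = d, s a) * √(∑ a with mask D a = d, s' a) := by
        rw [Finset.mul_sum]
        refine Finset.sum_congr rfl fun d _ => ?_
        rw [mul_mul_mul_comm, Real.mul_self_sqrt hL]
    _ ≤ _ := by
        refine mul_le_mul_of_nonneg_left ?_ hL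
        refine (Real.sum_sqrt_mul_sqrt_le _ (fun d => Finset.sum_nonneg fun a _ => hs a)
          fun d => Finset.sum_nonneg fun a _ => hs' a).trans_eq ?_
        rw [Finset.sum_fiberwise, Finset.sum_fiberwise]

end

/-! ### Guessing games with revealed bases -/

section

variable {n : ℕ}

/-- Generating function of the Hamming distance to `b` on the strings that agree with `b` outside
`R`. -/
lemma sum_pow_card_agree_compl (R : Finset (Fin n)) (b : Bits n) (c : ℝ) :
    ∑ b' : Bits n with mask Rᶜ b' = mask Rᶜ b, c ^ (agree b b')ᶜ.card = (1 + c) ^ R.card := by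
  have h : ∀ b' : Bits n, (if mask Rᶜ b' = mask Rᶜ b then c ^ (agree b b')ᶜ.card else 0) =
      ∏ i, if b i = b' i then (1 : ℝ) else if i ∈ R then c else 0 := by
    intro b'
    split_ifs with hm
    · rw [mask_eq_mask_iff] at hm
      rw [← Finset.prod_mul_prod_compl (agree b b'), Finset.prod_eq_one, one_mul,
        ← Finset.prod_const]
      · refine Finset.prod_congr rfl fun i hi => ?_
        rw [Finset.mem_compl, mem_agree] at hi
        have hR : i ∈ R := by
          by_contra hR
          exact hi (hm i (Finset.mem_compl.2 hR)).symm
        rw [if_neg hi, if_pos hR]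
      · intro i hi
        rw [if_pos (mem_agree.1 hi)]
    · rw [mask_eq_mask_iff] at hm
      push Not at hm
      obtain ⟨i, hi, hne⟩ := hm
      refine (Finset.prod_eq_zero (Finset.mem_univ i) ?_).symm
      rw [if_neg (Ne.symm hne), if_neg (Finset.mem_compl.1 hi)]
  have h2 : ∀ i, ∑ x : Bool, (if b i = x then (1 : ℝ) else if i ∈ R then c else 0) =
      if i ∈ R then 1 + c else 1 := by
    intro i
    cases b i <;> simp <;> split_ifs <;> ring
  rw [Finset.sum_filter, Finset.sum_congr rfl fun b' _ => h b', ← Fintype.piFinset_univ,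
    ← Finset.prod_univ_sum (fun _ => Finset.univ)
      fun i x => if b i = x then (1 : ℝ) else if i ∈ R then c else 0]
  simp only [h2, Finset.prod_ite_mem, Finset.univ_inter, Finset.prod_const]

variable {E : Type*} [NormedAddCommGroup E] [InnerProductSpace ℂ E]

/-- The part of `sum_bases_le` in which the bases outside `R` are fixed. The operators of the
different bases on `R` are almost orthogonal: their overlap loses a factor `1 / √2` for each
coordinate at which the bases differ. -/
lemma sum_bases_off_le (R : Finset (Fin n)) (m : Bool) (σ β : Bits n) {L : ℝ} (hL : 0 ≤ L)
    (V : Bits n → E) (y : Bits n → Bits n → E) (s : Bits n → Bits n → ℝ)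
    (hs : ∀ b a, 0 ≤ s b a)
    (hinner : ∀ b a, (inner ℂ (∑ x, token (a, b) x • V x) (y b a)).re = s b a)
    (h0 : ∀ b a, y b a ≠ 0 → ∀ i ∈ R, b i = m → a i = σ i)
    (hsq : ∀ b D, Rᶜ ⊆ D → SquareSummable D L (s b) (y b)) :
    ∑ b with mask Rᶜ b = mask Rᶜ β, ∑ a, s b a ≤
      L * (1 + (√2)⁻¹) ^ R.card * ∑ x, ‖V x‖ ^ 2 := by
  have hV : ∑ x, ‖V x‖ ^ 2 = ‖WithLp.toLp 2 V‖ ^ 2 := by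
    rw [PiLp.norm_sq_eq_of_L2]
  rw [hV]
  refine sum_le_of_overlap_le _ (WithLp.toLp 2 V)
    (fun b => WithLp.toLp 2 fun x => ∑ a, star (token (a, b) x) • y b a)
    (fun b => ∑ a, s b a) (fun b b' => L * (√2)⁻¹ ^ (agree b b')ᶜ.card) (by positivity)
    (fun b _ => Finset.sum_nonneg fun a _ => hs b a) ?_ (fun _ _ => by positivity)
    (fun b b' => by rw [agree_comm]) ?_ ?_
  · intro b _
    simp only [← hinner, ← Complex.re_sum]
    congr 1
    rw [PiLp.inner_apply]
    simp only [sum_inner, inner_sum, inner_smul_left, inner_smul_right, RCLike.star_def]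
    exact Finset.sum_comm
  · intro b hb b' hb'
    simp only [Finset.mem_filter_univ] at hb hb'
    have hbb := mask_eq_mask_iff.1 (hb.trans hb'.symm)
    have hR : ∀ i, b i ≠ b' i → i ∈ R := fun i hi => by
      by_contra h
      exact hi (hbb i (Finset.mem_compl.2 h))
    have hD : Rᶜ ⊆ agree b b' := fun i hi => mem_agree.2 (hbb i hi)
    have := norm_sum_overlap_le (σ := σ) (m := m) hL (hs b) (hs b')
      (fun a ha i hi => h0 b a ha i (hR i hi)) (fun a ha i hi => h0 b' a ha i (hR i hi))
      (hsq b _ hD) (hsq b' _ hD)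
    refine le_of_eq_of_le ?_ this
    congr 1
    rw [PiLp.inner_apply]
    have hx : ∀ x, inner ℂ (∑ a, star (token (a, b) x) • y b a)
        (∑ a', star (token (a', b') x) • y b' a') =
        ∑ a, ∑ a', star (token (a', b') x) * token (a, b) x * inner ℂ (y b a) (y b' a') := by
      intro x
      rw [sum_inner]
      refine Finset.sum_congr rfl fun a _ => ?_
      rw [inner_sum]
      refine Finset.sum_congr rfl fun a' _ => ?_
      rw [inner_smul_left, inner_smul_right]
      simp only [RCLike.star_def, Complex.conj_conj]
      ring
    refine (Finset.sum_congr rfl fun x _ => hx x).trans ?_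
    rw [Finset.sum_comm]
    refine Finset.sum_congr rfl fun a _ => ?_
    rw [Finset.sum_comm]
    exact Finset.sum_congr rfl fun a' _ => (Finset.sum_mul _ _ _).symm
  · intro b hb
    rw [Finset.mem_filter_univ] at hb
    rw [← Finset.mul_sum, ← hb, sum_pow_card_agree_compl]

/-- The optimal probability `cos² (π / 8)` of guessing one bit of a conjugate coding. -/
noncomputable def guess : ℝ := (1 + (√2)⁻¹) / 2

/-- If only those keys contribute whose bits encoded in the basis `m` are given by `σ` on `R`, then
the operators of all keys add up to at most `2 ^ n * guess ^ R.card * L`. Here `y b a` is the vector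
`N (V (token (a, b)))`, for a positive operator `N` depending on `a` and `b`, and `s b a` is its
inner product with `V (token (a, b))`. -/
lemma sum_bases_le (R : Finset (Fin n)) (m : Bool) (σ : Bits n) {L : ℝ} (hL : 0 ≤ L)
    (V : Bits n → E) (y : Bits n → Bits n → E) (s : Bits n → Bits n → ℝ)
    (hs : ∀ b a, 0 ≤ s b a)
    (hinner : ∀ b a, (inner ℂ (∑ x, token (a, b) x • V x) (y b a)).re = s b a)
    (h0 : ∀ b a, y b a ≠ 0 → ∀ i ∈ R, b i = m → a i = σ i)
    (hsq : ∀ b D, Rᶜ ⊆ D → SquareSummable D L (s b) (y b)) :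
    ∑ b, ∑ a, s b a ≤ 2 ^ n * guess ^ R.card * (L * ∑ x, ‖V x‖ ^ 2) := by
  -- Averaging over `β` counts each `b` once for each of the `2 ^ R.card` strings `β` that agree
  -- with it outside `R`.
  have h1 : ∑ β : Bits n, ∑ b with mask Rᶜ b = mask Rᶜ β, ∑ a, s b a =
      2 ^ R.card * ∑ b, ∑ a, s b a := by
    have h2 : ∀ b : Bits n, ∑ β : Bits n with mask Rᶜ β = mask Rᶜ b, (1 : ℝ) = 2 ^ R.card :=
      fun b => by
        have := sum_pow_card_agree_compl R b 1
        norm_num at this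
        simpa using this
    simp only [Finset.sum_filter]
    rw [Finset.sum_comm, Finset.mul_sum]
    refine Finset.sum_congr rfl fun b _ => ?_
    rw [← h2 b, Finset.sum_filter, Finset.sum_mul]
    refine Finset.sum_congr rfl fun β _ => ?_
    simp only [eq_comm (a := mask Rᶜ β), ite_mul, one_mul, zero_mul]
  have h3 : 2 ^ R.card * ∑ b, ∑ a, s b a ≤
      2 ^ n * (L * (1 + (√2)⁻¹) ^ R.card * ∑ x, ‖V x‖ ^ 2) := by
    rw [← h1]
    refine (Finset.sum_le_sum fun β _ =>
      sum_bases_off_le R m σ β hL V y s hs hinner h0 hsq).trans_eq ?_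
    simp
  rw [guess, div_pow]
  have h4 : (0 : ℝ) < 2 ^ R.card := by positivity
  refine le_of_mul_le_mul_left (h3.trans_eq ?_) h4
  field_simp

end

/-! ### Attempts to sign without a miss on a set of coordinates -/

section

/-- A finite family of rank-one measurement operators on a memory `X`, the outcome `j` being read as
the signature `out j`. The vector `e j` lists the coordinates of a bra, so that the amplitude of
the outcome `j` in the state `v` is `e j ⬝ᵥ v`, without a conjugation. The family need not be
normalized: the squared moduli of the amplitudes may add up to more than the squared norm of
`v`. -/
structure Attempts (n : ℕ) (X : Type) where
  /-- The outcomes. -/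
  J : Type
  /-- There are finitely many outcomes. -/
  fin : Fintype J
  /-- The signature attached to an outcome. -/
  out : J → Bits n
  /-- The measurement vector of an outcome. -/
  e : J → X → ℂ

attribute [instance] Attempts.fin

/-- The total weight of a family of attempts is at most `L`. -/
def Attempts.Bounded {n : ℕ} {X : Type} [Fintype X] (P : Attempts n X) (L : ℝ) : Prop :=
  ∀ v : X → ℂ, ∑ j, ‖P.e j ⬝ᵥ v‖ ^ 2 ≤ L * sqNorm v

variable {n : ℕ}

/-- What an adversary may learn about the key from the verification of signatures of `m`: all
bases, and the bits encoded in the basis `m` (the other bits are erased). -/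
def revealed (m : Bool) (k : Key n) : Key n :=
  (fun i => if k.2 i = m then k.1 i else false, k.2)

/-- No misses on `R`, neither for the signature `σ` of `m` nor for the signature `σ'` of the
other document. -/
def MatchOn (R : Finset (Fin n)) (k : Key n) (m : Bool) (σ σ' : Bits n) : Prop :=
  ∀ i ∈ R, k.1 i = if k.2 i = m then σ i else σ' i

instance (R : Finset (Fin n)) (k : Key n) (m : Bool) (σ σ' : Bits n) :
    Decidable (MatchOn R k m σ σ') := by unfold MatchOn; infer_instance

/-- All the strings `a` with bits `d` on `D` that contribute give the same revealed information, and
thus the same measurement; as a match on `R` determines `a`, each outcome counts for at most one of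
them. -/
lemma sum_matchOn_le {Y : Type} [Fintype Y] (P : Key n → Attempts n Y) {L : ℝ}
    (hP : ∀ c, (P c).Bounded L) {R D : Finset (Fin n)} (hD : Rᶜ ⊆ D) (m : Bool) (σ b d : Bits n)
    (u : Y → ℂ) :
    ∑ a with mask D a = d, ∑ j : (P (revealed m (a, b))).J,
      (if MatchOn R (a, b) m σ ((P (revealed m (a, b))).out j) then
        ‖(P (revealed m (a, b))).e j ⬝ᵥ u‖ ^ 2 else 0) ≤ L * sqNorm u := by
  -- The information revealed is the same for all `a` which contribute to the sum.
  set c : Key n := revealed m (fun i => if i ∈ R then σ i else d i, b) with hc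
  have hrev : ∀ a : Bits n, mask D a = d → (∀ i ∈ R, b i = m → a i = σ i) →
      revealed m (a, b) = c := by
    intro a ha haσ
    rw [hc]
    unfold revealed
    congr 1
    funext i
    by_cases hb : b i = m
    · by_cases hi : i ∈ R
      · simp [hb, hi, haσ i hi hb]
      · have hiD : i ∈ D := hD (Finset.mem_compl.2 hi)
        have : d i = a i := by rw [← ha]; simp [mask, hiD]
        simp [hb, hi, this]
    · simp [hb]
  calc _ ≤ ∑ a with mask D a = d, ∑ j : (P c).J,
        (if MatchOn R (a, b) m σ ((P c).out j) then ‖(P c).e j ⬝ᵥ u‖ ^ 2 else 0) := by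
        refine Finset.sum_le_sum fun a ha => ?_
        rw [Finset.mem_filter_univ] at ha
        by_cases haσ : ∀ i ∈ R, b i = m → a i = σ i
        · rw [hrev a ha haσ]
        · refine (Finset.sum_nonpos fun j _ => ?_).trans
            (Finset.sum_nonneg fun j _ => by split_ifs <;> positivity)
          rw [if_neg]
          intro hM
          exact haσ fun i hi hb => by simpa [hb] using hM i hi
    _ = ∑ j : (P c).J, ∑ a with mask D a = d,
        (if MatchOn R (a, b) m σ ((P c).out j) then ‖(P c).e j ⬝ᵥ u‖ ^ 2 else 0) :=
        Finset.sum_comm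
    _ ≤ ∑ j : (P c).J, ‖(P c).e j ⬝ᵥ u‖ ^ 2 := by
        refine Finset.sum_le_sum fun j _ => ?_
        rw [← Finset.sum_filter, Finset.sum_const, nsmul_eq_mul]
        refine mul_le_of_le_one_left (sq_nonneg _) ?_
        norm_cast
        refine Finset.card_le_one.2 fun a ha a' ha' => ?_
        simp only [Finset.mem_filter, Finset.mem_univ, true_and] at ha ha'
        funext i
        by_cases hi : i ∈ R
        · exact (ha.2 i hi).trans (ha'.2 i hi).symm
        · exact mask_eq_mask_iff.1 (ha.1.trans ha'.1.symm) i (hD (Finset.mem_compl.2 hi))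
    _ ≤ _ := hP c u

lemma toLp_mulVec {Y : Type} [Fintype Y] (V : Matrix Y (Bits n) ℂ) (w : Bits n → ℂ) :
    ∑ x, w x • (WithLp.toLp 2 (fun y => V y x) : EuclideanSpace ℂ Y) =
      WithLp.toLp 2 (V *ᵥ w) := by
  ext y
  simp [Matrix.mulVec, dotProduct, mul_comm]

lemma inner_toLp_star {Y : Type} [Fintype Y] (f e : Y → ℂ) :
    inner ℂ (WithLp.toLp 2 f : EuclideanSpace ℂ Y) (WithLp.toLp 2 (star e)) = star (e ⬝ᵥ f) := by
  simp [EuclideanSpace.inner_eq_star_dotProduct, dotProduct, mul_comm]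

lemma sqNorm_eq_norm_sq {Y : Type} [Fintype Y] (f : Y → ℂ) :
    sqNorm f = ‖(WithLp.toLp 2 f : EuclideanSpace ℂ Y)‖ ^ 2 := by
  rw [EuclideanSpace.norm_sq_eq]; rfl

/-- An adversary that has to be right on all of `R`: even if the bases and the bits encoded in the
basis `m` are revealed to it before it signs the other document, it succeeds with probability at
most `guess ^ R.card`. -/
lemma sum_matchOn_token_le {Y : Type} [Fintype Y] (P : Key n → Attempts n Y) {L : ℝ} (hL : 0 ≤ L)
    (hP : ∀ c, (P c).Bounded L) (R : Finset (Fin n)) (m : Bool) (σ : Bits n)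
    (V : Matrix Y (Bits n) ℂ) :
    ∑ b, ∑ a, ∑ j : (P (revealed m (a, b))).J,
      (if MatchOn R (a, b) m σ ((P (revealed m (a, b))).out j) then
        ‖(P (revealed m (a, b))).e j ⬝ᵥ (V *ᵥ token (a, b))‖ ^ 2 else 0) ≤
      2 ^ n * guess ^ R.card * (L * ∑ x, sqNorm fun y => V y x) := by
  simp only [sqNorm_eq_norm_sq]
  set y : Bits n → Bits n → EuclideanSpace ℂ Y := fun b a => ∑ j : (P (revealed m (a, b))).J,
    if MatchOn R (a, b) m σ ((P (revealed m (a, b))).out j) then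
      ((P (revealed m (a, b))).e j ⬝ᵥ (V *ᵥ token (a, b))) •
        (WithLp.toLp 2 (star ((P (revealed m (a, b))).e j)) : EuclideanSpace ℂ Y) else 0 with hy
  have hinn : ∀ (u : EuclideanSpace ℂ Y) b a, inner ℂ u (y b a) =
      ∑ j : (P (revealed m (a, b))).J, if MatchOn R (a, b) m σ ((P (revealed m (a, b))).out j) then
        ((P (revealed m (a, b))).e j ⬝ᵥ (V *ᵥ token (a, b))) *
          star ((P (revealed m (a, b))).e j ⬝ᵥ u.ofLp) else 0 := by
    intro u b a
    rw [hy, inner_sum]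
    refine Finset.sum_congr rfl fun j _ => ?_
    split_ifs
    · rw [inner_smul_right, ← inner_toLp_star]
    · simp
  refine sum_bases_le R m σ hL (fun x => WithLp.toLp 2 fun y => V y x) y _
    (fun b a => Finset.sum_nonneg fun j _ => by split_ifs <;> positivity) ?_ ?_ ?_
  · intro b a
    rw [toLp_mulVec, hinn, Complex.re_sum]
    refine Finset.sum_congr rfl fun j _ => ?_
    split_ifs
    · rw [RCLike.star_def, Complex.mul_conj, Complex.normSq_eq_norm_sq, Complex.ofReal_re]
    · simp
  · intro b a hne i hi hb
    by_contra hσ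
    refine hne (Finset.sum_eq_zero fun j _ => if_neg fun hM => hσ ?_)
    simpa [hb] using hM i hi
  · intro b D hD φ hφ d
    set u : EuclideanSpace ℂ Y := ∑ a with mask D a = d, φ a • y b a with hu
    set I : Finset (Σ a : Bits n, (P (revealed m (a, b))).J) :=
      (Finset.univ.filter fun a => mask D a = d).sigma fun a =>
        Finset.univ.filter fun j => MatchOn R (a, b) m σ ((P (revealed m (a, b))).out j)
    set S := ∑ a with mask D a = d, ∑ j : (P (revealed m (a, b))).J,
      (if MatchOn R (a, b) m σ ((P (revealed m (a, b))).out j) then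
        ‖(P (revealed m (a, b))).e j ⬝ᵥ (V *ᵥ token (a, b))‖ ^ 2 else 0) with hS
    set T := ∑ a with mask D a = d, ∑ j : (P (revealed m (a, b))).J,
      (if MatchOn R (a, b) m σ ((P (revealed m (a, b))).out j) then
        ‖(P (revealed m (a, b))).e j ⬝ᵥ u.ofLp‖ ^ 2 else 0) with hT
    have hTle : T ≤ L * ‖u‖ ^ 2 := by
      have := sum_matchOn_le P hP hD m σ b d u.ofLp
      rwa [sqNorm_eq_norm_sq] at this
    have hS0 : 0 ≤ S := Finset.sum_nonneg fun a _ => Finset.sum_nonneg fun j _ => by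
      split_ifs <;> positivity
    have h1 : ‖u‖ ^ 2 ≤ ∑ p ∈ I, ‖(P (revealed m (p.1, b))).e p.2 ⬝ᵥ (V *ᵥ token (p.1, b))‖ *
        ‖(P (revealed m (p.1, b))).e p.2 ⬝ᵥ u.ofLp‖ := by
      have h2 : ‖u‖ ^ 2 = ‖inner ℂ u u‖ := by
        rw [inner_self_eq_norm_sq_to_K]; simp
      rw [h2]
      nth_rewrite 2 [hu]
      rw [inner_sum, Finset.sum_sigma]
      refine (norm_sum_le _ _).trans (Finset.sum_le_sum fun a _ => ?_)
      rw [inner_smul_right, norm_mul, hinn]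
      refine (mul_le_of_le_one_left (norm_nonneg _) (hφ a)).trans ?_
      rw [← Finset.sum_filter]
      refine (norm_sum_le _ _).trans_eq (Finset.sum_congr rfl fun j _ => ?_)
      rw [norm_mul, norm_star]
    have h3 : (‖u‖ ^ 2) ^ 2 ≤ S * T := by
      calc (‖u‖ ^ 2) ^ 2 ≤ _ := pow_le_pow_left₀ (sq_nonneg _) h1 2
        _ ≤ _ := Finset.sum_mul_sq_le_sq_mul_sq _ _ _
        _ = S * T := by
          simp only [I, hS, hT, Finset.sum_sigma, Finset.sum_filter]
    have h4 : ‖u‖ ^ 2 * ‖u‖ ^ 2 ≤ L * S * ‖u‖ ^ 2 := by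
      calc ‖u‖ ^ 2 * ‖u‖ ^ 2 = (‖u‖ ^ 2) ^ 2 := by ring
        _ ≤ S * T := h3
        _ ≤ S * (L * ‖u‖ ^ 2) := mul_le_mul_of_nonneg_left hTle hS0
        _ = _ := by ring
    rcases (sq_nonneg ‖u‖).eq_or_lt with h | h
    · rw [← h]; positivity
    · exact le_of_mul_le_mul_right h4 h

end

/-! ### From exact matches to a bounded number of misses -/

section

variable {n : ℕ}

/-- The base of the exponential bound on the forging probability obtained from the weight `t` per
miss. -/
noncomputable def rate (η t : ℝ) : ℝ := t ^ (-(2 * η)) * ((1 - t) * guess + t)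

lemma guess_pos : 0 < guess := by unfold guess; positivity

lemma le_rate_factor {t : ℝ} (h0 : 0 ≤ t) (h1 : t ≤ 1) : 0 ≤ (1 - t) * guess + t :=
  add_nonneg (mul_nonneg (by linarith) guess_pos.le) h0

lemma rate_nonneg {η t : ℝ} (h0 : 0 ≤ t) (h1 : t ≤ 1) : 0 ≤ rate η t :=
  mul_nonneg (Real.rpow_nonneg h0 _) (le_rate_factor h0 h1)

/-- The exponential Markov inequality for the number of misses. -/
lemma one_le_rpow_mul_pow {t x : ℝ} (ht0 : 0 < t) (ht1 : t ≤ 1) {c : ℕ} (h : (c : ℝ) ≤ x * n) :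
    1 ≤ (t ^ (-x)) ^ n * t ^ c := by
  rw [← Real.rpow_natCast (t ^ (-x)), ← Real.rpow_mul ht0.le, ← Real.rpow_natCast t c,
    ← Real.rpow_add ht0]
  exact Real.one_le_rpow_of_pos_of_le_one_of_nonpos ht0 ht1 (by linarith)

/-- A weight `t` per miss is the probability of having no miss in a random set of coordinates,
which contains each coordinate with probability `1 - t`. -/
lemma pow_card_eq_sum_disjoint (W : Finset (Fin n)) (t : ℝ) :
    t ^ W.card = ∑ R : Finset (Fin n),
      (1 - t) ^ R.card * t ^ (n - R.card) * if Disjoint R W then 1 else 0 := by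
  have h : t ^ W.card = ∏ i, ((if i ∈ W then 0 else 1 - t) + t) := by
    rw [← Finset.prod_const, ← Finset.prod_ite_mem_eq W fun _ => t]
    refine Finset.prod_congr rfl fun i _ => ?_
    split_ifs <;> ring
  rw [h, Finset.prod_add, Finset.powerset_univ]
  refine Finset.sum_congr rfl fun R _ => ?_
  rw [Finset.prod_const, ← Finset.compl_eq_univ_sdiff, Finset.card_compl, Fintype.card_fin]
  split_ifs with hd
  · rw [Finset.prod_congr rfl fun i hi => if_neg (Finset.disjoint_left.1 hd hi),
      Finset.prod_const, mul_one]
  · obtain ⟨i, hi, hiW⟩ := Finset.not_disjoint_iff.1 hd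
    have hz : (if i ∈ W then (0 : ℝ) else 1 - t) = 0 := if_pos hiW
    rw [Finset.prod_eq_zero hi hz]
    ring

/-- Acceptance of both signatures, bounded by the probability of having no miss on a random set. -/
lemma ite_verify_le {η t : ℝ} (ht0 : 0 < t) (ht1 : t ≤ 1) (k : Key n) (m : Bool)
    (σ σ' : Bits n) :
    (if verify η k m σ ∧ verify η k (!m) σ' then (1 : ℝ) else 0) ≤
      (t ^ (-(2 * η))) ^ n * ∑ R : Finset (Fin n),
        (1 - t) ^ R.card * t ^ (n - R.card) * if MatchOn R k m σ σ' then 1 else 0 := by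
  set W : Finset (Fin n) :=
    Finset.univ.filter fun i => ¬ k.1 i = if k.2 i = m then σ i else σ' i with hW
  have hM : ∀ R, MatchOn R k m σ σ' ↔ Disjoint R W := by
    intro R
    simp only [MatchOn, Finset.disjoint_left, hW, Finset.mem_filter_univ, not_not]
  simp only [hM]
  rw [← pow_card_eq_sum_disjoint]
  split_ifs with hv
  · refine one_le_rpow_mul_pow ht0 ht1 ?_
    simp only [verify, decide_eq_true_eq] at hv
    have hsub : W ⊆ miss k m σ ∪ miss k (!m) σ' := by
      intro i hi
      rw [hW, Finset.mem_filter_univ] at hi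
      by_cases hk : k.2 i = m
      · rw [if_pos hk] at hi
        simp [miss, hk, Ne.symm hi]
      · rw [if_neg hk] at hi
        have : k.2 i = !m := by revert hk; cases k.2 i <;> cases m <;> simp
        simp [miss, this, Ne.symm hi]
    have hc : (W.card : ℝ) ≤ (miss k m σ).card + (miss k (!m) σ').card := by
      exact_mod_cast (Finset.card_le_card hsub).trans (Finset.card_union_le _ _)
    linarith [hv.1, hv.2]
  · positivity

/-- After a valid signature `σ` of `m`, the signatures of the other document that can be produced
from the token are valid with exponentially small probability, even if the choice of the
measurement depends on everything that the verification of signatures of `m` reveals. -/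
lemma sum_verify_le {η t : ℝ} (ht0 : 0 < t) (ht1 : t ≤ 1) {Y : Type} [Fintype Y]
    (P : Key n → Attempts n Y) {L : ℝ} (hL : 0 ≤ L) (hP : ∀ c, (P c).Bounded L) (m : Bool)
    (σ : Bits n) (V : Matrix Y (Bits n) ℂ) :
    ∑ k : Key n, (if verify η k m σ then ∑ j : (P (revealed m k)).J,
      (if verify η k (!m) ((P (revealed m k)).out j) then
        ‖(P (revealed m k)).e j ⬝ᵥ (V *ᵥ token k)‖ ^ 2 else 0) else 0) ≤
      rate η t ^ n * (2 ^ n * (L * ∑ x, sqNorm fun y => V y x)) := by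
  set Q : (R : Finset (Fin n)) → Key n → ℝ := fun R k => ∑ j : (P (revealed m k)).J,
    (if MatchOn R k m σ ((P (revealed m k)).out j) then
      ‖(P (revealed m k)).e j ⬝ᵥ (V *ᵥ token k)‖ ^ 2 else 0) with hQ
  have hpt : ∀ k : Key n, (if verify η k m σ then ∑ j : (P (revealed m k)).J,
      (if verify η k (!m) ((P (revealed m k)).out j) then
        ‖(P (revealed m k)).e j ⬝ᵥ (V *ᵥ token k)‖ ^ 2 else 0) else 0) ≤
      (t ^ (-(2 * η))) ^ n * ∑ R : Finset (Fin n),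
        (1 - t) ^ R.card * t ^ (n - R.card) * Q R k := by
    intro k
    calc _ = ∑ j : (P (revealed m k)).J,
          (if verify η k m σ ∧ verify η k (!m) ((P (revealed m k)).out j) then (1 : ℝ) else 0) *
            ‖(P (revealed m k)).e j ⬝ᵥ (V *ᵥ token k)‖ ^ 2 := by
          by_cases h : verify η k m σ = true <;> simp [h]
      _ ≤ ∑ j : (P (revealed m k)).J, ((t ^ (-(2 * η))) ^ n * ∑ R : Finset (Fin n),
          (1 - t) ^ R.card * t ^ (n - R.card) *
            if MatchOn R k m σ ((P (revealed m k)).out j) then 1 else 0) *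
            ‖(P (revealed m k)).e j ⬝ᵥ (V *ᵥ token k)‖ ^ 2 :=
          Finset.sum_le_sum fun j _ =>
            mul_le_mul_of_nonneg_right (ite_verify_le ht0 ht1 k m σ _) (sq_nonneg _)
      _ = _ := by
          simp only [hQ, mul_assoc, ← Finset.mul_sum, Finset.sum_mul]
          rw [Finset.sum_comm]
          simp only [← Finset.mul_sum, ite_mul, one_mul, zero_mul]
  have hR : ∀ R, ∑ k, Q R k ≤ guess ^ R.card * (2 ^ n * (L * ∑ x, sqNorm fun y => V y x)) := by
    intro R
    rw [Fintype.sum_prod_type_right]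
    refine (sum_matchOn_token_le P hL hP R m σ V).trans_eq (by ring)
  calc _ ≤ ∑ k : Key n, (t ^ (-(2 * η))) ^ n * ∑ R : Finset (Fin n),
        (1 - t) ^ R.card * t ^ (n - R.card) * Q R k := Finset.sum_le_sum fun k _ => hpt k
    _ = (t ^ (-(2 * η))) ^ n * ∑ R : Finset (Fin n),
        (1 - t) ^ R.card * t ^ (n - R.card) * ∑ k, Q R k := by
        rw [← Finset.mul_sum, Finset.sum_comm]
        simp only [← Finset.mul_sum]
    _ ≤ (t ^ (-(2 * η))) ^ n * ∑ R : Finset (Fin n), (1 - t) ^ R.card * t ^ (n - R.card) *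
        (guess ^ R.card * (2 ^ n * (L * ∑ x, sqNorm fun y => V y x))) := by
        have : 0 ≤ 1 - t := by linarith
        gcongr with R _
        exact hR R
    _ = (t ^ (-(2 * η))) ^ n * (∑ R : Finset (Fin n),
        ((1 - t) * guess) ^ R.card * t ^ (Fintype.card (Fin n) - R.card)) *
        (2 ^ n * (L * ∑ x, sqNorm fun y => V y x)) := by
        rw [mul_assoc, Finset.sum_mul, Fintype.card_fin]
        congr 1
        refine Finset.sum_congr rfl fun R _ => ?_
        rw [mul_pow]; ring
    _ = _ := by
        rw [Fintype.sum_pow_mul_eq_add_pow, Fintype.card_fin, ← mul_pow]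
        rfl

/-- Without a token, a signature is valid for few keys only. -/
lemma sum_ite_verify_le {η t : ℝ} (hη : 0 ≤ η) (ht0 : 0 < t) (ht1 : t ≤ 1) (m : Bool)
    (σ : Bits n) : ∑ k : Key n, (if verify η k m σ then (1 : ℝ) else 0) ≤ 4 ^ n * rate η t ^ n := by
  have h1 : ∀ k : Key n, (if verify η k m σ then (1 : ℝ) else 0) ≤
      (t ^ (-η)) ^ n * t ^ (miss k m σ).card := by
    intro k
    split_ifs with hv
    · exact one_le_rpow_mul_pow ht0 ht1 (by simpa [verify] using hv)
    · positivity
  have h2 : ∀ k : Key n, t ^ (miss k m σ).card =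
      ∏ i, if k.2 i = m ∧ σ i ≠ k.1 i then t else 1 := by
    intro k
    rw [← Finset.prod_const, miss, Finset.prod_filter]
  have h3 : ∀ i, ∑ x : Bool, ∑ z : Bool, (if z = m ∧ σ i ≠ x then t else 1) = 3 + t := by
    intro i
    cases m <;> cases σ i <;> simp <;> ring
  have h4 : ∑ k : Key n, t ^ (miss k m σ).card = (3 + t) ^ n := by
    simp only [h2, Fintype.sum_prod_type]
    have h5 : ∀ x : Bits n, ∑ z : Bits n, ∏ i, (if z i = m ∧ σ i ≠ x i then t else 1) =
        ∏ i, ∑ z : Bool, if z = m ∧ σ i ≠ x i then t else 1 := by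
      intro x
      rw [Finset.prod_univ_sum, Fintype.piFinset_univ]
    simp only [h5]
    rw [← Fintype.piFinset_univ, ← Finset.prod_univ_sum (fun _ => Finset.univ)
      fun i x => ∑ z : Bool, if z = m ∧ σ i ≠ x then t else 1]
    simp only [h3, Finset.prod_const, Finset.card_univ, Fintype.card_fin]
  -- Without the token a coordinate is a miss with probability `1 / 4`, which exceeds `1 - guess`.
  have h6 : 3 / 4 + t / 4 ≤ (1 - t) * guess + t := by
    have : (3 : ℝ) / 4 ≤ guess := by
      have h : (1 : ℝ) / 2 ≤ (√2)⁻¹ := by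
        rw [one_div]
        exact inv_anti₀ (by positivity) (Real.sqrt_le_iff.2 (by norm_num))
      unfold guess
      linarith
    nlinarith
  calc _ ≤ ∑ k : Key n, (t ^ (-η)) ^ n * t ^ (miss k m σ).card :=
        Finset.sum_le_sum fun k _ => h1 k
    _ = (4 * (t ^ (-η) * (3 / 4 + t / 4))) ^ n := by
        rw [← Finset.mul_sum, h4, ← mul_pow]
        congr 1
        ring
    _ ≤ (4 * rate η t) ^ n := by
        unfold rate
        have : t ^ (-η) ≤ t ^ (-(2 * η)) :=
          Real.rpow_le_rpow_of_exponent_ge ht0 ht1 (by linarith)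
        gcongr
    _ = _ := mul_pow _ _ _

end

/-! ### Reduction of adaptive strategies to attempts -/

section

variable {n : ℕ} {η : ℝ}

/-- The number of chances of a strategy to produce a valid signature. -/
def Strategy.attempts {X : Type} (S : Strategy n X) : ℕ := S.verifyQueries + S.submissions

lemma mem_miss {k : Key n} {m : Bool} {σ : Bits n} {i : Fin n} :
    i ∈ miss k m σ ↔ k.2 i = m ∧ σ i ≠ k.1 i := by simp [miss]

lemma verify_revealed (k : Key n) (m : Bool) (σ : Bits n) :
    verify η (revealed m k) m σ = verify η k m σ := by
  have : miss (revealed m k) m σ = miss k m σ := by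
    ext i
    rw [mem_miss, mem_miss]
    refine and_congr_right fun h => ?_
    simp only [revealed, if_pos (show k.2 i = m from h)]
  rw [verify, verify, this]

lemma two_le_validCount {k : Key n} {L : List (Bool × Bits n)} (h : 2 ≤ validCount η k L)
    (m : Bool) : ∃ p ∈ L, p.1 = m ∧ verify η k m p.2 := by
  have huniv : ((L.filter fun p => verify η k p.1 p.2).map Prod.fst).toFinset = Finset.univ :=
    Finset.eq_univ_of_card _ (le_antisymm (Finset.card_le_univ _) h)
  have hm := Finset.mem_univ m
  rw [← huniv] at hm
  simp only [List.mem_toFinset, List.mem_map, List.mem_filter] at hm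
  obtain ⟨p, ⟨hp, hv⟩, rfl⟩ := hm
  exact ⟨p, hp, rfl, hv⟩

lemma attempts_measure_le {X Y : Type} [DecidableEq X] [Fintype Y] {o : ℕ}
    (K : Fin o → Matrix Y X ℂ) (hK : ∑ i, (K i)ᴴ * K i = 1) (next : Fin o → Strategy n Y)
    (i : Fin o) : (next i).attempts ≤ (Strategy.measure K hK next).attempts := by
  simp only [Strategy.attempts, Strategy.verifyQueries, Strategy.submissions]
  exact add_le_add (Finset.le_sup (f := fun i => (next i).verifyQueries) (Finset.mem_univ i))
    (Finset.le_sup (f := fun i => (next i).submissions) (Finset.mem_univ i))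

lemma attempts_queryVerify_le {X : Type} (m : Bool) (σ : Bits n) (next : Bool → Strategy n X)
    (x : Bool) : (next x).attempts + 1 ≤ (Strategy.queryVerify m σ next).attempts := by
  simp only [Strategy.attempts, Strategy.verifyQueries, Strategy.submissions]
  cases x <;> omega

lemma tokenQueries_measure_le {X Y : Type} [DecidableEq X] [Fintype Y] {o : ℕ}
    (K : Fin o → Matrix Y X ℂ) (hK : ∑ i, (K i)ᴴ * K i = 1) (next : Fin o → Strategy n Y)
    (i : Fin o) : (next i).tokenQueries ≤ (Strategy.measure K hK next).tokenQueries := by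
  simp only [Strategy.tokenQueries]
  exact Finset.le_sup (f := fun i => (next i).tokenQueries) (Finset.mem_univ i)

lemma tokenQueries_queryVerify_le {X : Type} (m : Bool) (σ : Bits n)
    (next : Bool → Strategy n X) (x : Bool) :
    (next x).tokenQueries ≤ (Strategy.queryVerify m σ next).tokenQueries := by
  simp only [Strategy.tokenQueries]
  cases x <;> simp

open Classical in
/-- A vector of the computational basis. -/
noncomputable def basisVec {X : Type} (x : X) : X → ℂ := Pi.single x 1

lemma sum_basisVec_dotProduct {X : Type} [Fintype X] (v : X → ℂ) :
    ∑ x, ‖basisVec x ⬝ᵥ v‖ ^ 2 = sqNorm v := by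
  simp [sqNorm, basisVec]

/-- Once the answers to all queries on the document `m` are known, the rest of a strategy amounts
to a number of attempts to produce a valid signature of the other document: its other queries may
be taken to be answered negatively up to the first success. -/
lemma exists_attempts (c : Key n) (m : Bool) {X : Type} (S : Strategy n X) :
    S.tokenQueries = 0 → ∀ [Fintype X], ∃ P : Attempts n X, P.Bounded S.attempts ∧
      ∀ k, revealed m k = c → ∀ v : X → ℂ, winProb η k S 1 (pureState v) ≤
        ∑ j, if verify η k (!m) (P.out j) then ‖P.e j ⬝ᵥ v‖ ^ 2 else 0 := by
  induction S with
  | @submit X L =>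
    intro _ _
    refine ⟨⟨Fin L.length × X, inferInstance, fun j => (L.get j.1).2,
      fun j => if (L.get j.1).1 = !m then basisVec j.2 else 0⟩, ?_, ?_⟩
    · intro v
      simp only [Fintype.sum_prod_type, Strategy.attempts, Strategy.verifyQueries,
        Strategy.submissions, zero_add]
      calc _ ≤ ∑ _i : Fin L.length, sqNorm v := by
            refine Finset.sum_le_sum fun i _ => ?_
            split_ifs
            · rw [sum_basisVec_dotProduct]
            · simpa using sqNorm_nonneg v
        _ = _ := by simp
    · intro k _ v
      simp only [winProb, trace_pureState]
      split_ifs with h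
      · obtain ⟨p, hp, hp1, hp2⟩ := two_le_validCount h (!m)
        obtain ⟨i, rfl⟩ := List.mem_iff_get.1 hp
        rw [Fintype.sum_prod_type]
        refine le_trans ?_ (Finset.single_le_sum (fun i _ => Finset.sum_nonneg fun x _ => ?_)
          (Finset.mem_univ i))
        · simp only [hp1, hp2, if_true]
          rw [sum_basisVec_dotProduct]
        · split_ifs <;> positivity
      · exact Finset.sum_nonneg fun j _ => by split_ifs <;> positivity
  | @queryVerify X m' σ next ih =>
    intro hS _
    have h0 : ∀ x, (next x).tokenQueries = 0 := fun x =>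
      Nat.le_zero.1 (hS ▸ tokenQueries_queryVerify_le m' σ next x)
    have hN : ∀ x, ((next x).attempts : ℝ) + 1 ≤ (Strategy.queryVerify m' σ next).attempts :=
      fun x => by exact_mod_cast attempts_queryVerify_le m' σ next x
    by_cases hm : m' = m
    -- The answer to a query on `m` is determined by the information revealed.
    · subst hm
      obtain ⟨P, hP, hw⟩ := ih (verify η c m' σ) (h0 _)
      refine ⟨P, fun v => (hP v).trans ?_, fun k hk v => ?_⟩
      · exact mul_le_mul_of_nonneg_right (by linarith [hN (verify η c m' σ)]) (sqNorm_nonneg v)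
      · have := hw k hk v
        simp only [winProb]
        rwa [← hk, verify_revealed] at this
    -- A query on the other document is an attempt, whatever the state of the memory; if it fails,
    -- the answer is negative.
    · obtain ⟨P, hP, hw⟩ := ih false (h0 _)
      have hm' : m' = !m := by revert hm; cases m <;> cases m' <;> simp
      subst hm'
      refine ⟨⟨X ⊕ P.J, inferInstance, Sum.elim (fun _ => σ) P.out,
        Sum.elim basisVec P.e⟩, fun v => ?_, fun k hk v => ?_⟩
      · simp only [Fintype.sum_sum_type, Sum.elim_inl, Sum.elim_inr]
        rw [sum_basisVec_dotProduct]
        have h1 := hP v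
        have h2 := mul_le_mul_of_nonneg_right (hN false) (sqNorm_nonneg v)
        linarith
      · rw [Fintype.sum_sum_type]
        change winProb η k (next (verify η k (!m) σ)) 1 (pureState v) ≤
          (∑ x : X, if verify η k (!m) σ then ‖basisVec x ⬝ᵥ v‖ ^ 2 else 0) +
            ∑ j, if verify η k (!m) (P.out j) then ‖P.e j ⬝ᵥ v‖ ^ 2 else 0
        have hrest : 0 ≤ ∑ j, if verify η k (!m) (P.out j) then ‖P.e j ⬝ᵥ v‖ ^ 2 else 0 :=
          Finset.sum_nonneg fun j _ => by split_ifs <;> positivity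
        rcases Bool.eq_false_or_eq_true (verify η k (!m) σ) with hv | hv
        · simp only [hv, if_true]
          rw [sum_basisVec_dotProduct]
          linarith [(winProb_mem_Icc (η := η) (k := k) (next true) 1 v).2]
        · have := hw k hk v
          simpa [hv] using this
  | queryToken next _ =>
    intro hS
    simp [Strategy.tokenQueries] at hS
  | measure K hK next ih =>
    intro hS inst
    have h0 : ∀ i, (next i).tokenQueries = 0 := fun i =>
      Nat.le_zero.1 (hS ▸ tokenQueries_measure_le K hK next i)
    choose P hP hw using fun i => ih i (h0 i)
    refine ⟨⟨Σ i, (P i).J, inferInstance, fun j => (P j.1).out j.2,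
      fun j => (P j.1).e j.2 ᵥ* K j.1⟩, fun v => ?_, fun k hk v => ?_⟩
    · simp only [Fintype.sum_sigma, ← Matrix.dotProduct_mulVec]
      rw [← sum_sqNorm_mulVec hK v, Finset.mul_sum]
      refine Finset.sum_le_sum fun i _ => (hP i _).trans ?_
      refine mul_le_mul_of_nonneg_right ?_ (sqNorm_nonneg _)
      exact_mod_cast attempts_measure_le K hK next i
    · simp only [Fintype.sum_sigma, ← Matrix.dotProduct_mulVec]
      rw [winProb_measure]
      exact Finset.sum_le_sum fun i _ => hw i k hk _

/-! ### The three phases of the game -/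

/-- The squared Hilbert-Schmidt norm of the map that takes the token to the memory. -/
noncomputable def hsNorm {Y : Type} [Fintype Y] (V : Matrix Y (Bits n) ℂ) : ℝ :=
  ∑ x, sqNorm fun y => V y x

lemma hsNorm_nonneg {Y : Type} [Fintype Y] (V : Matrix Y (Bits n) ℂ) : 0 ≤ hsNorm V :=
  Finset.sum_nonneg fun _ _ => sqNorm_nonneg _

lemma sum_hsNorm_mul {X Y : Type} [Fintype X] [DecidableEq X] [Fintype Y] {o : ℕ}
    {K : Fin o → Matrix Y X ℂ} (hK : ∑ i, (K i)ᴴ * K i = 1) (V : Matrix X (Bits n) ℂ) :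
    ∑ i, hsNorm (K i * V) = hsNorm V := by
  unfold hsNorm
  rw [Finset.sum_comm]
  exact Finset.sum_congr rfl fun x _ => sum_sqNorm_mulVec hK fun y => V y x

/-- The memory is `V (token k)`, and `σ` has just been accepted as a signature of `m`. -/
lemma sum_winProb_of_verify_le {t : ℝ} (ht0 : 0 < t) (ht1 : t ≤ 1) {Y : Type} [Fintype Y]
    (S : Strategy n Y) (hS : S.tokenQueries = 0) (V : Matrix Y (Bits n) ℂ) (m : Bool) (σ : Bits n) :
    ∑ k : Key n, (if verify η k m σ then winProb η k S 1 (pureState (V *ᵥ token k)) else 0) ≤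
      rate η t ^ n * (2 ^ n * (S.attempts * hsNorm V)) := by
  choose P hP hw using fun c => exists_attempts (η := η) c m S hS
  refine le_trans (Finset.sum_le_sum fun k _ => ?_)
    (sum_verify_le ht0 ht1 P (Nat.cast_nonneg _) hP m σ V)
  split_ifs
  · exact hw _ k rfl _
  · exact le_rfl

/-- The memory is `V (token k)`, and no signature has been accepted so far: the position in the
tree, hence `V`, does not depend on the key. -/
lemma sum_winProb_of_token_le {t : ℝ} (ht0 : 0 < t) (ht1 : t ≤ 1) {Y : Type} (S : Strategy n Y) :
    S.tokenQueries = 0 → ∀ [Fintype Y] (V : Matrix Y (Bits n) ℂ),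
    ∑ k : Key n, winProb η k S 1 (pureState (V *ᵥ token k)) ≤
      rate η t ^ n * (2 ^ n * ((S.attempts : ℝ) ^ 2 * hsNorm V)) := by
  have hr : 0 ≤ rate η t := rate_nonneg ht0.le ht1
  induction S with
  | submit L =>
    intro hS _ V
    have hpt : ∀ k : Key n, winProb η k (.submit L) 1 (pureState (V *ᵥ token k)) ≤
        ∑ i : Fin L.length, if verify η k (L.get i).1 (L.get i).2 then
          winProb η k (.submit L) 1 (pureState (V *ᵥ token k)) else 0 := by
      intro k
      have hw := (winProb_mem_Icc (η := η) (k := k) (.submit L) 1 (V *ᵥ token k)).1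
      by_cases h : 2 ≤ validCount η k L
      · obtain ⟨p, hp, hp1, hp2⟩ := two_le_validCount h true
        obtain ⟨i, rfl⟩ := List.mem_iff_get.1 hp
        refine le_trans ?_ (Finset.single_le_sum (fun i _ => ?_) (Finset.mem_univ i))
        · rw [hp1, if_pos hp2]
        · split_ifs
          · exact hw
          · exact le_rfl
      · have h0 : winProb η k (.submit L) 1 (pureState (V *ᵥ token k)) = 0 := by
          simp only [winProb]
          exact if_neg h
        simp [h0]
    refine (Finset.sum_le_sum fun k _ => hpt k).trans ?_
    rw [Finset.sum_comm]
    refine (Finset.sum_le_sum fun i _ =>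
      sum_winProb_of_verify_le ht0 ht1 (.submit L) hS V _ _).trans_eq ?_
    simp only [Finset.sum_const, Finset.card_univ, Fintype.card_fin, nsmul_eq_mul,
      Strategy.attempts, Strategy.verifyQueries, Strategy.submissions, zero_add]
    ring
  | queryVerify m σ next ih =>
    intro hS _ V
    have h0 : ∀ x, (next x).tokenQueries = 0 := fun x =>
      Nat.le_zero.1 (hS ▸ tokenQueries_queryVerify_le m σ next x)
    have hN : ∀ x, ((next x).attempts : ℝ) + 1 ≤ (Strategy.queryVerify m σ next).attempts :=
      fun x => by exact_mod_cast attempts_queryVerify_le m σ next x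
    set N : ℝ := (((Strategy.queryVerify m σ next).attempts : ℕ) : ℝ)
    have hpt : ∀ k : Key n, winProb η k (.queryVerify m σ next) 1 (pureState (V *ᵥ token k)) ≤
        (if verify η k m σ then winProb η k (next true) 1 (pureState (V *ᵥ token k)) else 0) +
          winProb η k (next false) 1 (pureState (V *ᵥ token k)) := by
      intro k
      have hw := (winProb_mem_Icc (η := η) (k := k) (next false) 1 (V *ᵥ token k)).1
      simp only [winProb]
      cases verify η k m σ <;> simp [hw]
    refine (Finset.sum_le_sum fun k _ => hpt k).trans ?_
    rw [Finset.sum_add_distrib]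
    have h1 := sum_winProb_of_verify_le (η := η) ht0 ht1 (next true) (h0 _) V m σ
    have h2 := ih false (h0 _) V
    have h3 : ((next true).attempts : ℝ) + ((next false).attempts : ℝ) ^ 2 ≤ N ^ 2 := by
      have a1 := hN true
      have a2 := hN false
      have a3 : (0 : ℝ) ≤ (next true).attempts := Nat.cast_nonneg _
      have a4 : (0 : ℝ) ≤ (next false).attempts := Nat.cast_nonneg _
      nlinarith
    calc _ ≤ rate η t ^ n * (2 ^ n * ((((next true).attempts : ℝ) +
          ((next false).attempts : ℝ) ^ 2) * hsNorm V)) := by linarith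
      _ ≤ _ := by
        have := hsNorm_nonneg V
        gcongr
  | queryToken next _ =>
    intro hS
    simp [Strategy.tokenQueries] at hS
  | measure K hK next ih =>
    intro hS inst V
    have h0 : ∀ i, (next i).tokenQueries = 0 := fun i =>
      Nat.le_zero.1 (hS ▸ tokenQueries_measure_le K hK next i)
    simp only [winProb_measure, Matrix.mulVec_mulVec]
    rw [Finset.sum_comm, ← sum_hsNorm_mul hK V, Finset.mul_sum, Finset.mul_sum, Finset.mul_sum]
    refine Finset.sum_le_sum fun i _ => (ih i (h0 i) (K i * V)).trans ?_
    have h1 := hsNorm_nonneg (K i * V)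
    have h2 : ((next i).attempts : ℝ) ≤ (Strategy.measure K hK next).attempts := by
      exact_mod_cast attempts_measure_le K hK next i
    gcongr

/-- The token has not been handed out, and no signature has been accepted so far. -/
lemma sum_winProb_le {t : ℝ} (ht0 : 0 < t) (ht1 : t ≤ 1) (hη : 0 ≤ η) {X : Type}
    (S : Strategy n X) : S.tokenQueries ≤ 1 → ∀ [Fintype X] (v : X → ℂ),
    ∑ k : Key n, winProb η k S 0 (pureState v) ≤
      4 ^ n * rate η t ^ n * (((S.attempts : ℝ) + (S.attempts : ℝ) ^ 2) * sqNorm v) := by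
  have hr : 0 ≤ rate η t := rate_nonneg ht0.le ht1
  induction S with
  | submit L =>
    intro _ _ v
    have hv0 := sqNorm_nonneg v
    have hpt : ∀ k : Key n, winProb η k (.submit L) 0 (pureState v) ≤
        ∑ i : Fin L.length, (if verify η k (L.get i).1 (L.get i).2 then (1 : ℝ) else 0) *
          sqNorm v := by
      intro k
      simp only [winProb, trace_pureState]
      split_ifs with h
      · have hpos : 0 < validCount η k L := by omega
        obtain ⟨m, hm⟩ := Finset.card_pos.1 hpos
        simp only [List.mem_toFinset, List.mem_map, List.mem_filter] at hm
        obtain ⟨p, ⟨hp, hv⟩, -⟩ := hm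
        obtain ⟨i, rfl⟩ := List.mem_iff_get.1 hp
        refine le_trans ?_ (Finset.single_le_sum (fun i _ => ?_) (Finset.mem_univ i))
        · rw [if_pos hv, one_mul]
        · positivity
      · positivity
    refine (Finset.sum_le_sum fun k _ => hpt k).trans ?_
    rw [Finset.sum_comm]
    calc _ ≤ ∑ _i : Fin L.length, 4 ^ n * rate η t ^ n * sqNorm v := by
          refine Finset.sum_le_sum fun i _ => ?_
          rw [← Finset.sum_mul]
          exact mul_le_mul_of_nonneg_right (sum_ite_verify_le hη ht0 ht1 _ _) hv0
      _ = 4 ^ n * rate η t ^ n * (L.length * sqNorm v) := by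
          simp only [Finset.sum_const, Finset.card_univ, Fintype.card_fin, nsmul_eq_mul]
          ring
      _ ≤ _ := by
          simp only [Strategy.attempts, Strategy.verifyQueries, Strategy.submissions, zero_add]
          gcongr
          exact le_add_of_nonneg_right (sq_nonneg _)
  | queryVerify m σ next ih =>
    intro hS _ v
    have hv0 := sqNorm_nonneg v
    have hN : ((next false).attempts : ℝ) + 1 ≤ (Strategy.queryVerify m σ next).attempts := by
      exact_mod_cast attempts_queryVerify_le m σ next false
    set N : ℝ := (((Strategy.queryVerify m σ next).attempts : ℕ) : ℝ)
    have hpt : ∀ k : Key n, winProb η k (.queryVerify m σ next) 0 (pureState v) ≤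
        (if verify η k m σ then (1 : ℝ) else 0) * sqNorm v +
          winProb η k (next false) 0 (pureState v) := by
      intro k
      have h1 := (winProb_mem_Icc (η := η) (k := k) (next false) 0 v).1
      have h2 := (winProb_mem_Icc (η := η) (k := k) (next true) 0 v).2
      simp only [winProb]
      cases verify η k m σ <;> simp only [Bool.false_eq_true, if_true, if_false] <;> linarith
    refine (Finset.sum_le_sum fun k _ => hpt k).trans ?_
    rw [Finset.sum_add_distrib, ← Finset.sum_mul]
    have h1 := mul_le_mul_of_nonneg_right (sum_ite_verify_le hη ht0 ht1 m σ) hv0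
    have h2 := ih false ((tokenQueries_queryVerify_le m σ next false).trans hS) v
    have h3 : 1 + (((next false).attempts : ℝ) + ((next false).attempts : ℝ) ^ 2) ≤
        N + N ^ 2 := by
      have a4 : (0 : ℝ) ≤ (next false).attempts := Nat.cast_nonneg _
      nlinarith
    calc _ ≤ 4 ^ n * rate η t ^ n * ((1 + (((next false).attempts : ℝ) +
          ((next false).attempts : ℝ) ^ 2)) * sqNorm v) := by linarith
      _ ≤ _ := by gcongr
  | @queryToken X next _ =>
    intro hS _ v
    have hS0 : next.tokenQueries = 0 := by simpa [Strategy.tokenQueries] using hS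
    -- Appending the token to the memory `v` is the linear map `v ⊗ 1` applied to the token.
    set V : Matrix (X × Bits n) (Bits n) ℂ :=
      Matrix.of fun p x => v p.1 * if p.2 = x then 1 else 0 with hV
    have hVt : ∀ k : Key n, V *ᵥ token k = fun p => v p.1 * token k p.2 := by
      intro k
      funext p
      simp [hV, Matrix.mulVec, dotProduct]
    have hVn : hsNorm V = 2 ^ n * sqNorm v := by
      have h1 : ∀ x : Bits n, sqNorm (fun p => V p x) = sqNorm v := by
        intro x
        have h2 := sqNorm_tensor v fun y : Bits n => if y = x then (1 : ℂ) else 0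
        have h3 : sqNorm (fun y : Bits n => if y = x then (1 : ℂ) else 0) = 1 := by
          simp [sqNorm, apply_ite]
        rw [h3, mul_one] at h2
        exact h2
      simp [hsNorm, h1]
    simp only [winProb_queryToken, zero_add, ← hVt]
    refine (sum_winProb_of_token_le ht0 ht1 next hS0 V).trans ?_
    have hatt : (Strategy.queryToken next).attempts = next.attempts := rfl
    have h4 : (4 : ℝ) ^ n = 2 ^ n * 2 ^ n := by rw [← mul_pow]; norm_num
    rw [hVn, hatt, h4]
    have hv0 := sqNorm_nonneg v
    calc _ = 2 ^ n * 2 ^ n * rate η t ^ n * ((next.attempts : ℝ) ^ 2 * sqNorm v) := by ring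
      _ ≤ _ := by
        gcongr
        exact le_add_of_nonneg_left (Nat.cast_nonneg _)
  | measure K hK next ih =>
    intro hS inst v
    simp only [winProb_measure]
    rw [Finset.sum_comm, ← sum_sqNorm_mulVec hK v, Finset.mul_sum, Finset.mul_sum]
    refine Finset.sum_le_sum fun i _ =>
      (ih i ((tokenQueries_measure_le K hK next i).trans hS) _).trans ?_
    have h1 := sqNorm_nonneg (K i *ᵥ v)
    have h2 : ((next i).attempts : ℝ) ≤ (Strategy.measure K hK next).attempts := by
      exact_mod_cast attempts_measure_le K hK next i
    gcongr

lemma forgeProb_nonneg (S : Strategy n Unit) : 0 ≤ forgeProb η n S := by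
  have h1 : (1 : Matrix Unit Unit ℂ) = pureState fun _ => 1 := by
    ext i j; simp [pureState, Matrix.vecMulVec_apply]
  unfold forgeProb
  rw [h1]
  exact div_nonneg (Finset.sum_nonneg fun k _ => (winProb_mem_Icc S 0 _).1) (Nat.cast_nonneg _)

lemma forgeProb_le {t : ℝ} (ht0 : 0 < t) (ht1 : t ≤ 1) (hη : 0 ≤ η) (S : Strategy n Unit)
    (hS : S.tokenQueries ≤ 1) :
    forgeProb η n S ≤
      ((S.verifyQueries : ℝ) + (S.submissions : ℝ) + 1) ^ 2 * rate η t ^ n := by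
  have h1 : (1 : Matrix Unit Unit ℂ) = pureState fun _ => 1 := by
    ext i j; simp [pureState, Matrix.vecMulVec_apply]
  have h := sum_winProb_le ht0 ht1 hη S hS fun _ => 1
  have hsq : sqNorm (fun _ : Unit => (1 : ℂ)) = 1 := by simp [sqNorm]
  have hcard : (Fintype.card (Key n) : ℝ) = 4 ^ n := by
    simp only [Fintype.card_prod, Fintype.card_fun, Fintype.card_bool, Fintype.card_fin]
    push_cast
    rw [← mul_pow]
    norm_num
  rw [hsq, mul_one, mul_assoc] at h
  unfold forgeProb
  rw [h1, hcard, div_le_iff₀' (by positivity)]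
  refine h.trans (mul_le_mul_of_nonneg_left ?_ (by positivity))
  rw [mul_comm]
  refine mul_le_mul_of_nonneg_right ?_ (pow_nonneg (rate_nonneg ht0.le ht1) _)
  simp only [Strategy.attempts]
  push_cast
  nlinarith [(Nat.cast_nonneg S.verifyQueries : (0 : ℝ) ≤ _),
    (Nat.cast_nonneg S.submissions : (0 : ℝ) ≤ _)]

/-! ### Constants and negligibility -/

lemma guess_eq_cos_sq : guess = Real.cos (Real.pi / 8) ^ 2 := by
  rw [Real.cos_sq, show 2 * (Real.pi / 8) = Real.pi / 4 by ring, Real.cos_pi_div_four, guess]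
  have : √2 * √2 = 2 := Real.mul_self_sqrt (by norm_num)
  have h : (√2)⁻¹ = √2 / 2 := by
    field_simp
    linarith
  rw [h]
  ring

/-- The logarithm of `rate η t` is at most `(1 - t) * (2 * η / t - (1 - guess))`, which is negative
for `t` slightly less than `1`. -/
lemma exists_rate_lt_one (hη0 : 0 < η) (hη : η < (1 - guess) / 2) :
    ∃ t, 0 < t ∧ t ≤ 1 ∧ 0 < rate η t ∧ rate η t < 1 := by
  have hg : 0 < 1 - guess := by linarith
  obtain ⟨t, ht2, ht1⟩ := exists_between (show 2 * η / (1 - guess) < 1 by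
    rw [div_lt_one hg]; linarith)
  have ht0 : 0 < t := lt_trans (by positivity) ht2
  rw [div_lt_iff₀ hg] at ht2
  have hf : 0 < (1 - t) * guess + t :=
    add_pos_of_nonneg_of_pos (mul_nonneg (by linarith) guess_pos.le) ht0
  have hpos : 0 < rate η t := mul_pos (Real.rpow_pos_of_pos ht0 _) hf
  refine ⟨t, ht0, ht1.le, hpos, ?_⟩
  rw [← Real.log_neg_iff hpos, rate, Real.log_mul (Real.rpow_pos_of_pos ht0 _).ne' hf.ne',
    Real.log_rpow ht0]
  have h1 := Real.log_le_sub_one_of_pos hf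
  have h2 := Real.one_sub_inv_le_log_of_pos ht0
  have h3 : 2 * η * t⁻¹ < 1 - guess := by
    rw [← div_eq_mul_inv, div_lt_iff₀ ht0]
    linarith
  have h4 : t⁻¹ - 1 = (1 - t) * t⁻¹ := by
    rw [sub_mul, mul_inv_cancel₀ ht0.ne', one_mul]
  have h5 : -(2 * η) * Real.log t ≤ 2 * η * (t⁻¹ - 1) := by nlinarith
  have h6 : (1 - t) * (2 * η * t⁻¹) < (1 - t) * (1 - guess) :=
    mul_lt_mul_of_pos_left h3 (by linarith)
  rw [h4] at h5
  linarith

lemma PolyBounded.negligible_mul_pow {f g : ℕ → ℕ} (hf : PolyBounded f) (hg : PolyBounded g)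
    {ρ : ℝ} (h0 : 0 ≤ ρ) (h1 : ρ < 1) {p : ℕ → ℝ} (hp0 : ∀ n, 0 ≤ p n)
    (hp : ∀ n, p n ≤ ((f n : ℝ) + (g n : ℝ) + 1) ^ 2 * ρ ^ n) : Negligible p := by
  obtain ⟨P, hP⟩ := hf
  obtain ⟨Q, hQ⟩ := hg
  have hρ : Asymptotics.SuperpolynomialDecay Filter.atTop (fun n : ℕ => (n : ℝ))
      fun n => ρ ^ n := fun z => tendsto_pow_const_mul_const_pow_of_lt_one z h0 h1
  have hmul := hρ.polynomial_mul (((P + Q + 1) ^ 2).map (Nat.castRingHom ℝ))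
  refine hmul.trans_eventually_abs_le (Filter.Eventually.of_forall fun n => ?_)
  have hev : (((P + Q + 1) ^ 2).map (Nat.castRingHom ℝ)).eval (n : ℝ) =
      (((P.eval n : ℕ) : ℝ) + ((Q.eval n : ℕ) : ℝ) + 1) ^ 2 := by
    rw [Polynomial.eval_natCast_map]
    simp
  have hPn : (f n : ℝ) ≤ (P.eval n : ℕ) := by exact_mod_cast hP n
  have hQn : (g n : ℝ) ≤ (Q.eval n : ℕ) := by exact_mod_cast hQ n
  simp only [Function.comp_apply, hev]
  refine abs_le_abs_of_nonneg (hp0 n) ((hp n).trans ?_)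
  gcongr

lemma unconditionallyUnforgeable (hη0 : 0 < η) (hη : η < (1 - guess) / 2) :
    UnconditionallyUnforgeable η := by
  obtain ⟨t, ht0, ht1, hr0, hr1⟩ := exists_rate_lt_one hη0 hη
  intro A hA hq hw
  exact hq.negligible_mul_pow hw hr0.le hr1 (fun n => forgeProb_nonneg _)
    fun n => forgeProb_le ht0 ht1 hη0.le (A n) (hA n)

end

end ConjugateTMAC

theorem mainTheorem2 :
    (∀ η : ℝ, 0 < η → η < (1 - Real.cos (Real.pi / 8) ^ 2) / 2 →
      ConjugateTMAC.UnconditionallyUnforgeable η ∧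
      ∃ C ρ : ℝ, 0 < C ∧ 0 < ρ ∧ ρ < 1 ∧
        ∀ (n : ℕ) (S : ConjugateTMAC.Strategy n Unit), S.tokenQueries ≤ 1 →
          ConjugateTMAC.forgeProb η n S ≤
            C * ((S.verifyQueries : ℝ) + (S.submissions : ℝ) + 1) ^ 2 * ρ ^ n) ∧
    ((7 / 100 : ℝ) < (1 - Real.cos (Real.pi / 8) ^ 2) / 2 ∧
      ConjugateTMAC.UnconditionallyUnforgeable (7 / 100)) := by
  rw [← ConjugateTMAC.guess_eq_cos_sq]
  have h7 : (7 / 100 : ℝ) < (1 - ConjugateTMAC.guess) / 2 := by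
    have h : (√2)⁻¹ < 18 / 25 := by
      rw [inv_lt_comm₀ (by positivity) (by norm_num)]
      exact Real.lt_sqrt_of_sq_lt (by norm_num)
    unfold ConjugateTMAC.guess
    linarith
  refine ⟨fun η hη0 hη => ⟨ConjugateTMAC.unconditionallyUnforgeable hη0 hη, ?_⟩, h7,
    ConjugateTMAC.unconditionallyUnforgeable (by norm_num) h7⟩
  obtain ⟨t, ht0, ht1, hr0, hr1⟩ := ConjugateTMAC.exists_rate_lt_one hη0 hη
  refine ⟨1, ConjugateTMAC.rate η t, one_pos, hr0, hr1, fun n S hS => ?_⟩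
  rw [one_mul]
  exact ConjugateTMAC.forgeProb_le ht0 ht1 hη0.le S hS
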